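/- Let $k\ge 2$, let $\mathcal S^{k-1}=\{v\in\mathbb R^k:\|v\|=1\}$ carry its surface area measure $\sigma$, and for $\kappa>0$, $\theta\in\mathcal S^{k-1}$ let the Fisher–von Mises–Langevin (FvML) distribution with concentration $\kappa$ and location $\theta$ be the probability measure on $\mathcal S^{k-1}$ with density $f_{\kappa,\theta}(x)=c_{k,\kappa}\exp(\kappa x'\theta)$ with respect to $\sigma$, where $c_{k,\kappa}=\left(\int_{\mathcal S^{k-1}}e^{\kappa y'\theta}\,d\sigma(y)\right)^{-1}$ (which does not depend on $\theta$). Let $\mathrm P^{(n)}_{\vartheta}$, $\vartheta=(\kappa,\theta')'\in(0,\infty)\times\mathcal S^{k-1}$, be the joint distribution of $n$ i.i.d. observations $X_1,\dots,X_n$ with density $f_{\kappa,\theta}$. Put $$A_k(\kappa)=\frac{\int_{-1}^1 t e^{\kappa t}(1-t^2)^{(k-3)/2}dt}{\int_{-1}^1 e^{\kappa t}(1-t^2)^{(k-3)/2}dt},\qquad \mathcal J_k(\kappa)=\int_{-1}^1(1-u^2)\tilde f_\kappa(u)\,du,$$ where $\tilde f_\kappa$ is the probability density on $[-1,1]$ proportional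 to $e^{\kappa t}(1-t^2)^{(k-3)/2}$, and let $S_\theta(x)=(x-(x'\theta)\theta)/\|x-(x'\theta)\theta\|$ (with value $0$ on the null set where the denominator vanishes). Define the central sequence $\Delta^{(n)}_\vartheta=(\Delta^{(\mathrm I)(n)}_\vartheta,(\Delta^{(\mathrm{II})(n)}_\vartheta)')'$ by $$\Delta^{(\mathrm I)(n)}_\vartheta=n^{-1/2}\sum_{i=1}^n\left(X_i'\theta-A_k(\kappa)\right),\qquad \Delta^{(\mathrm{II})(n)}_\vartheta=\kappa n^{-1/2}\sum_{i=1}^n\left(1-(X_i'\theta)^2\right)^{1/2}S_\theta(X_i),$$ and the block-diagonal Fisher information matrix $\Gamma_\vartheta=\mathrm{diag}(\Gamma^{(\mathrm I)}_\vartheta,\Gamma^{(\mathrm{II})}_\vartheta)$ by $$\Gamma^{(\mathrm I)}_\vartheta=1-\frac{k-1}{\kappa}A_k(\kappa)-A_k(\kappa)^2,\qquad \Gamma^{(\mathrm{II})}_\vartheta=\frac{\kappa^2\mathcal J_k(\kappa)}{k-1}\left(I_k-\theta\theta'\right).$$ Then the family $\{\mathrm P^{(n)}_\vartheta:\vartheta\in(0,\infty)\times\mathcal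 S^{k-1}\}$ is uniformly locally asymptotically normal (ULAN) with rate $n^{-1/2}$. More precisely, let $\vartheta=(\kappa,\theta')'\in(0,\infty)\times\mathcal S^{k-1}$, let $\vartheta^{(n)}=(\kappa^{(n)},(\theta^{(n)})')'\in(0,\infty)\times\mathcal S^{k-1}$ be any sequence with $\vartheta^{(n)}-\vartheta=O(n^{-1/2})$, and let $\tau^{(n)}=(c^{(n)},(t^{(n)})')'\in\mathbb R\times\mathbb R^k$ be any bounded sequence such that $\kappa^{(n)}+n^{-1/2}c^{(n)}>0$ and $\theta^{(n)}+n^{-1/2}t^{(n)}\in\mathcal S^{k-1}$ for all $n\ge1$. Then, under $\mathrm P^{(n)}_{\vartheta^{(n)}}$ as $n\to\infty$, $$\log\frac{d\mathrm P^{(n)}_{\vartheta^{(n)}+n^{-1/2}\tau^{(n)}}}{d\mathrm P^{(n)}_{\vartheta^{(n)}}}=(\tau^{(n)})'\Delta^{(n)}_{\vartheta^{(n)}}-\frac12(\tau^{(n)})'\Gamma_\vartheta\tau^{(n)}+o_{\mathrm P}(1),$$ the matrix $\Gamma_\vartheta$ is positive semidefinite, and $\Delta^{(n)}_{\vartheta^{(n)}}$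 converges in distribution to $\mathcal N_{k+1}(0,\Gamma_\vartheta)$. -/

import Mathlib

open MeasureTheory ProbabilityTheory Filter Topology

namespace FvML

noncomputable section

/-- The ambient space `ℝ^k` with its Euclidean inner product. -/
abbrev Vec (k : ℕ) : Type := EuclideanSpace ℝ (Fin k)

/-- The unit sphere `S^{k-1}` of `ℝ^k`. -/
abbrev Sph (k : ℕ) : Type := Metric.sphere (0 : Vec k) 1

/-- The surface area measure on `S^{k-1}`. -/
def surface (k : ℕ) : Measure (Sph k) := (volume : Measure (Vec k)).toSphere

/-- The FvML density `c exp (κ x'θ)` with respect to the surface area measure, where `1 / c` is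
the integral of `exp (κ y'θ)` over the sphere. -/
def density {k : ℕ} (κ : ℝ) (θ : Vec k) (x : Sph k) : ℝ :=
  Real.exp (κ * inner ℝ (x : Vec k) θ) /
    ∫ y : Sph k, Real.exp (κ * inner ℝ (y : Vec k) θ) ∂(surface k)

/-- The FvML distribution with concentration `κ` and location `θ`. -/
def dist {k : ℕ} (κ : ℝ) (θ : Vec k) : Measure (Sph k) :=
  (surface k).withDensity fun x => ENNReal.ofReal (density κ θ x)

/-- The joint distribution of `n` i.i.d. FvML observations with parameters `κ`, `θ`. -/
def joint {k : ℕ} (n : ℕ) (κ : ℝ) (θ : Vec k) : Measure (Fin n → Sph k) :=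
  Measure.pi fun _ : Fin n => dist κ θ

instance {k : ℕ} [NeZero k] (κ : ℝ) (θ : Vec k) : IsProbabilityMeasure (dist κ θ) := by
  have h1 : IsFiniteMeasure (surface k) := by unfold surface; infer_instance
  have h2 : NeZero (surface k) := by
    have : Nontrivial (Vec k) := by
      have : Nonempty (Fin k) := ⟨0⟩
      infer_instance
    exact ⟨Measure.toSphere_ne_zero _⟩
  have hc : Continuous fun x : Sph k => Real.exp (κ * inner ℝ (x : Vec k) θ) := by fun_prop
  have hint : Integrable (fun x : Sph k => Real.exp (κ * inner ℝ (x : Vec k) θ)) (surface k) :=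
    hc.integrable_of_hasCompactSupport (HasCompactSupport.of_compactSpace _)
  exact isProbabilityMeasure_tilted hint

instance {k : ℕ} [NeZero k] (n : ℕ) (κ : ℝ) (θ : Vec k) : IsProbabilityMeasure (joint n κ θ) := by
  unfold joint
  infer_instance

/-- The density on `[-1, 1]` proportional to `exp (κ t) (1 - t²)^{(k-3)/2}`. It is only ever
evaluated on that interval. -/
def projDensity (k : ℕ) (κ t : ℝ) : ℝ :=
  Real.exp (κ * t) * (1 - t ^ 2) ^ (((k : ℝ) - 3) / 2) /
    ∫ u in (-1 : ℝ)..1, Real.exp (κ * u) * (1 - u ^ 2) ^ (((k : ℝ) - 3) / 2)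

/-- The function `A_k`. -/
def A (k : ℕ) (κ : ℝ) : ℝ :=
  (∫ t in (-1 : ℝ)..1, t * Real.exp (κ * t) * (1 - t ^ 2) ^ (((k : ℝ) - 3) / 2)) /
    ∫ t in (-1 : ℝ)..1, Real.exp (κ * t) * (1 - t ^ 2) ^ (((k : ℝ) - 3) / 2)

/-- The function `J_k`. -/
def J (k : ℕ) (κ : ℝ) : ℝ := ∫ u in (-1 : ℝ)..1, (1 - u ^ 2) * projDensity k κ u

/-- The spherical sign `S_θ(x)`: the normalized component of `x` orthogonal to `θ`
(equal to `0` when that component vanishes). -/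
def sgn {k : ℕ} (θ x : Vec k) : Vec k :=
  ‖x - inner ℝ x θ • θ‖⁻¹ • (x - inner ℝ x θ • θ)

/-- The vector `(c, t')'` of `ℝ × ℝ^k = ℝ^{k+1}`. -/
def stack {k : ℕ} (c : ℝ) (t : Vec k) : EuclideanSpace ℝ (Fin 1 ⊕ Fin k) :=
  WithLp.toLp 2 (Sum.elim (fun _ => c) t)

/-- The concentration part of the central sequence. -/
def centralI {k : ℕ} (n : ℕ) (κ : ℝ) (θ : Vec k) (x : Fin n → Sph k) : ℝ :=
  (Real.sqrt n)⁻¹ * ∑ i, (inner ℝ (x i : Vec k) θ - A k κ)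

/-- The location part of the central sequence. -/
def centralII {k : ℕ} (n : ℕ) (κ : ℝ) (θ : Vec k) (x : Fin n → Sph k) : Vec k :=
  (κ * (Real.sqrt n)⁻¹) •
    ∑ i, Real.sqrt (1 - (inner ℝ (x i : Vec k) θ) ^ 2) • sgn θ (x i : Vec k)

/-- The central sequence. -/
def central {k : ℕ} (n : ℕ) (κ : ℝ) (θ : Vec k) (x : Fin n → Sph k) :
    EuclideanSpace ℝ (Fin 1 ⊕ Fin k) :=
  stack (centralI n κ θ x) (centralII n κ θ x)

/-- The concentration block of the Fisher information. -/
def fisherI (k : ℕ) (κ : ℝ) : ℝ := 1 - ((k : ℝ) - 1) / κ * A k κ - (A k κ) ^ 2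

/-- The location block of the Fisher information. -/
def fisherII {k : ℕ} (κ : ℝ) (θ : Vec k) : Matrix (Fin k) (Fin k) ℝ :=
  (κ ^ 2 * J k κ / ((k : ℝ) - 1)) • (1 - Matrix.vecMulVec θ θ)

/-- The block-diagonal Fisher information. -/
def fisher {k : ℕ} (κ : ℝ) (θ : Vec k) : Matrix (Fin 1 ⊕ Fin k) (Fin 1 ⊕ Fin k) ℝ :=
  Matrix.fromBlocks (Matrix.of fun _ _ => fisherI k κ) 0 0 (fisherII κ θ)

/-- The log-likelihood ratio `log (dP / dQ)` of the joint distribution `P` with parameters `κ'`, `θ'`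
over the joint distribution `Q` with parameters `κ`, `θ`. -/
def logLR {k : ℕ} (n : ℕ) (κ' : ℝ) (θ' : Vec k) (κ : ℝ) (θ : Vec k) (x : Fin n → Sph k) : ℝ :=
  Real.log (((joint n κ' θ').rnDeriv (joint n κ θ) x).toReal)

end

end FvML

namespace FvML

open scoped ENNReal
open Measure Set

/-! The FvML laws form an exponential family with natural parameter `κ • θ`: each is an exponential
tilt of any other. Hence the log-likelihood ratio is exact (`logLR_ae_eq`): a sum of centred linear
statistics `score` in the direction of the natural-parameter difference, minus `n` times a cumulant
generating function. On the sphere that difference is `n^{-1/2}` times `tangent + n^{-1/2}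
curvature` (`naturalParameter_sub`). The tangent part of the sum is exactly the pairing of `τ` with
the central sequence (`inner_stack_central`). The curvature part has vanishing variance and dies by
Chebyshev (`joint_sum_score_ge_le`). The cumulant term tends to half the variance of one score
(`tendsto_quadratic_sub_log`). This variance `varForm` is the Fisher quadratic form
(`stack_dotProduct_fisher`), which also gives positive semidefiniteness. The identification needs
the law of `x'θ`, the symmetry of the law about `θ`, and the integration by parts `J = (k-1)/κ * A`.
Scores are bounded by `2 * ‖h‖` whatever the parameters, so all Taylor errors are explicit and
uniform. The expansions are taken at the moving parameter, and its convergence suffices. The same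
bounds give the central limit theorem through characteristic functions. -/

/-! ### Polar coordinates and rotation invariance of the surface measure. -/

lemma lintegral_volumeIoiPow (n : ℕ) {f : ℝ → ℝ≥0∞} (hf : Measurable f) :
    ∫⁻ r : Ioi (0 : ℝ), f r ∂(volumeIoiPow n) =
      ∫⁻ r in Ioi (0 : ℝ), ENNReal.ofReal (r ^ n) * f r := by
  rw [volumeIoiPow, lintegral_withDensity_eq_lintegral_mul _ (by fun_prop) (by fun_prop)]
  exact lintegral_subtype_comap measurableSet_Ioi fun r => ENNReal.ofReal (r ^ n) * f r

lemma lintegral_homogeneous_mul_norm {E : Type*} [NormedAddCommGroup E] [NormedSpace ℝ E]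
    [FiniteDimensional ℝ E] [MeasurableSpace E] [BorelSpace E] [Nontrivial E]
    (μ : Measure E) [μ.IsAddHaarMeasure] {g : E → ℝ≥0∞} (hg : Measurable g)
    (hgh : ∀ r : ℝ, 0 < r → ∀ x, g (r • x) = g x) {φ : ℝ → ℝ≥0∞} (hφ : Measurable φ) :
    ∫⁻ x, g x * φ ‖x‖ ∂μ = (∫⁻ x, g x ∂μ.toSphere) *
      ∫⁻ r in Ioi (0 : ℝ), ENNReal.ofReal (r ^ (Module.finrank ℝ E - 1)) * φ r := by
  calc ∫⁻ x, g x * φ ‖x‖ ∂μ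
      = ∫⁻ x : ({(0)}ᶜ : Set E), g x.1 * φ ‖x.1‖ ∂(μ.comap (↑)) := by
        rw [lintegral_subtype_comap (measurableSet_singleton _).compl fun x ↦ g x * φ (‖x‖),
          restrict_compl_singleton]
    _ = ∫⁻ p, g p.1 * φ p.2 ∂μ.toSphere.prod (.volumeIoiPow (Module.finrank ℝ E - 1)) := by
        rw [← μ.measurePreserving_homeomorphUnitSphereProd.lintegral_comp_emb
          (Homeomorph.measurableEmbedding _)]
        refine lintegral_congr fun x => ?_
        have hx : 0 < ‖(x : E)‖ := norm_pos_iff.2 x.2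
        simp [hgh _ (inv_pos.2 hx)]
    _ = _ := by
        rw [← lintegral_volumeIoiPow _ hφ, lintegral_prod_mul
          (f := fun x : Metric.sphere (0 : E) 1 => g x)
          (g := fun r : Ioi (0 : ℝ) => φ r)]
        · exact (hg.comp measurable_subtype_coe).aemeasurable
        · exact (hφ.comp measurable_subtype_coe).aemeasurable

/-- The indicator function of the unit ball, as a function of the norm. -/
noncomputable def ballWeight (r : ℝ) : ℝ≥0∞ := (Iio (1 : ℝ)).indicator 1 r

lemma measurable_ballWeight : Measurable ballWeight :=
  measurable_one.indicator measurableSet_Iio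

lemma lintegral_pow_mul_ballWeight (n : ℕ) :
    ∫⁻ r in Ioi (0 : ℝ), ENNReal.ofReal (r ^ n) * ballWeight r =
      ENNReal.ofReal (1 / ((n : ℝ) + 1)) := by
  rw [← lintegral_volumeIoiPow _ measurable_ballWeight]
  have h := volumeIoiPow_apply_Iio n ⟨1, by simp⟩
  have h2 : (fun r : Ioi (0 : ℝ) => ballWeight r) =
      (Iio (⟨1, by simp⟩ : Ioi (0 : ℝ))).indicator 1 := by
    ext r
    simp only [ballWeight, indicator, mem_Iio, ← Subtype.coe_lt_coe, Pi.one_apply]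
  rw [h2, lintegral_indicator_one measurableSet_Iio, h]
  simp

lemma ofReal_one_div_succ_ne_zero (n : ℕ) : ENNReal.ofReal (1 / ((n : ℝ) + 1)) ≠ 0 := by
  simp only [ne_eq, ENNReal.ofReal_eq_zero, not_le]; positivity

instance (k : ℕ) : IsFiniteMeasure (surface k) := by unfold surface; infer_instance

instance (k : ℕ) [NeZero k] : Nontrivial (Vec k) := by
  have : Nonempty (Fin k) := ⟨0⟩
  infer_instance

instance (k : ℕ) [NeZero k] : NeZero (surface k) := ⟨toSphere_ne_zero _⟩

/-- Integrating a degree-zero homogeneous function over the unit ball recovers its surface integral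
up to a constant, so facts about Lebesgue measure pass to the sphere. -/
lemma lintegral_surface {k : ℕ} [NeZero k] {g : Vec k → ℝ≥0∞} (hg : Measurable g) :
    ∫⁻ x, g (‖x‖⁻¹ • x) * ballWeight ‖x‖ =
      (∫⁻ x, g x ∂surface k) * ENNReal.ofReal (1 / ((k - 1 : ℕ) + 1)) := by
  rw [← lintegral_pow_mul_ballWeight, lintegral_homogeneous_mul_norm volume (by fun_prop)
    _ measurable_ballWeight, surface]
  · congr 1
    · refine lintegral_congr fun x => ?_
      simp
    · simp
  · intro r hr x
    congr 1
    rw [norm_smul, Real.norm_of_nonneg hr.le, smul_smul]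
    congr 1
    field_simp

lemma lintegral_surface_comp_isometry {k : ℕ} [NeZero k] (L : Vec k ≃ₗᵢ[ℝ] Vec k)
    {g : Vec k → ℝ≥0∞} (hg : Measurable g) :
    ∫⁻ x, g (L x) ∂surface k = ∫⁻ x, g x ∂surface k := by
  have h1 := lintegral_surface hg
  have h2 := lintegral_surface (g := fun x => g (L x)) (hg.comp L.continuous.measurable)
  have h3 : ∫⁻ x, g (L (‖x‖⁻¹ • x)) * ballWeight ‖x‖ = ∫⁻ x, g (‖x‖⁻¹ • x) * ballWeight ‖x‖ := by
    rw [← (L.measurePreserving).lintegral_comp (f := fun x => g (‖x‖⁻¹ • x) * ballWeight ‖x‖)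
      (by have := measurable_ballWeight; fun_prop)]
    simp
  rw [h2, h1] at h3
  exact (ENNReal.mul_left_inj (ofReal_one_div_succ_ne_zero _) ENNReal.ofReal_ne_top).1 h3

/-! ### The law of one coordinate under the surface measure. -/

/-- The orthogonal splitting of `ℝ^{m+1}` along the first coordinate. -/
noncomputable def splitFirst (m : ℕ) : Vec (m + 1) ≃ᵐ ℝ × Vec m :=
  (MeasurableEquiv.toLp 2 (Fin (m + 1) → ℝ)).symm.trans
    ((MeasurableEquiv.piFinSuccAbove (fun _ => ℝ) 0).trans
      ((MeasurableEquiv.refl ℝ).prodCongr (MeasurableEquiv.toLp 2 (Fin m → ℝ))))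

lemma measurePreserving_splitFirst (m : ℕ) :
    MeasurePreserving (splitFirst m) volume volume := by
  refine ((MeasurePreserving.id volume).prod
    (PiLp.volume_preserving_toLp (Fin m))).comp
    ((volume_preserving_piFinSuccAbove (fun _ : Fin (m + 1) => ℝ) 0).comp
      (PiLp.volume_preserving_ofLp (Fin (m + 1))))

lemma splitFirst_fst (m : ℕ) (x : Vec (m + 1)) : (splitFirst m x).1 = x 0 := rfl

lemma sqrt_splitFirst (m : ℕ) (x : Vec (m + 1)) :
    √(x 0 ^ 2 + ‖(splitFirst m x).2‖ ^ 2) = ‖x‖ := by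
  rw [EuclideanSpace.norm_eq x, EuclideanSpace.norm_sq_eq, Fin.sum_univ_succ]
  simp only [Real.norm_eq_abs, sq_abs]
  rfl

/-- Substitution `t = cos α`: the Jacobian `sin α` raises the power `m - 1` of the sine to `m`. -/
lemma lintegral_cos (m : ℕ) {g : ℝ → ℝ≥0∞} :
    ∫⁻ t in Ioo (-1 : ℝ) 1, ENNReal.ofReal ((1 - t ^ 2) ^ (((m : ℝ) - 1) / 2)) * g t =
      ∫⁻ α in Ioo 0 Real.pi, ENNReal.ofReal (Real.sin α ^ m) * g (Real.cos α) := by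
  have himg : Real.cos '' Ioo 0 Real.pi = Ioo (-1) 1 := by
    ext t
    constructor
    · rintro ⟨α, ⟨h0, h1⟩, rfl⟩
      constructor
      · rw [← Real.cos_pi]; exact Real.cos_lt_cos_of_nonneg_of_le_pi h0.le le_rfl h1
      · rw [← Real.cos_zero]; exact Real.cos_lt_cos_of_nonneg_of_le_pi le_rfl h1.le h0
    · rintro ⟨h0, h1⟩
      exact ⟨Real.arccos t, ⟨Real.arccos_pos.2 h1, Real.arccos_lt_pi.2 h0⟩,
        Real.cos_arccos h0.le h1.le⟩
  rw [← himg, lintegral_image_eq_lintegral_abs_deriv_mul measurableSet_Ioo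
    (fun α _ => (Real.hasDerivAt_cos α).hasDerivWithinAt)
    (Real.injOn_cos.mono Ioo_subset_Icc_self)]
  refine setLIntegral_congr_fun measurableSet_Ioo fun α hα => ?_
  have hs : 0 < Real.sin α := Real.sin_pos_of_mem_Ioo hα
  rw [← mul_assoc, ← ENNReal.ofReal_mul (abs_nonneg _), ← Real.sin_sq, abs_neg, abs_of_pos hs,
    ← Real.rpow_natCast _ 2, ← Real.rpow_mul hs.le]
  congr 2
  nth_rewrite 1 [← Real.rpow_one (Real.sin α)]
  rw [← Real.rpow_add hs, ← Real.rpow_natCast]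
  congr 1
  push_cast
  ring

/-- Polar coordinates in the meridian half-plane, where `u` is the position along the axis and `s >
0` the distance to it; only angles in `(0, π)` contribute. -/
lemma lintegral_upperHalfPlane (m : ℕ) {g φ : ℝ → ℝ≥0∞} (hg : Measurable g) (hφ : Measurable φ) :
    ∫⁻ u, ∫⁻ s in Ioi (0 : ℝ), ENNReal.ofReal (s ^ m) *
        (g (u / √(u ^ 2 + s ^ 2)) * φ (√(u ^ 2 + s ^ 2))) =
      (∫⁻ r in Ioi (0 : ℝ), ENNReal.ofReal (r ^ (m + 1)) * φ r) *
        ∫⁻ α in Ioo 0 Real.pi, ENNReal.ofReal (Real.sin α ^ m) * g (Real.cos α) := by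
  set F : ℝ × ℝ → ℝ≥0∞ := fun p => (Ioi (0 : ℝ)).indicator (fun s => ENNReal.ofReal (s ^ m) *
        (g (p.1 / √(p.1 ^ 2 + s ^ 2)) * φ (√(p.1 ^ 2 + s ^ 2)))) p.2 with hF
  have hFm : Measurable F := by
    have : F = (Prod.snd ⁻¹' (Ioi (0 : ℝ))).indicator (fun p : ℝ × ℝ => ENNReal.ofReal (p.2 ^ m) *
        (g (p.1 / √(p.1 ^ 2 + p.2 ^ 2)) * φ (√(p.1 ^ 2 + p.2 ^ 2)))) := by
      ext p; simp [hF, indicator]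
    rw [this]
    exact Measurable.indicator (by fun_prop) (measurable_snd measurableSet_Ioi)
  calc _ = ∫⁻ u, ∫⁻ s, F (u, s) := by
        refine lintegral_congr fun u => ?_
        rw [← lintegral_indicator measurableSet_Ioi]
    _ = ∫⁻ p, F p := (lintegral_prod _ hFm.aemeasurable).symm
    _ = ∫⁻ p in polarCoord.target, ENNReal.ofReal p.1 • F (polarCoord.symm p) :=
        (lintegral_comp_polarCoord_symm F).symm
    _ = ∫⁻ p in (Ioi (0 : ℝ)) ×ˢ (Ioo (-Real.pi) Real.pi),
          (ENNReal.ofReal (p.1 ^ (m + 1)) * φ p.1) *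
          (Ioo 0 Real.pi).indicator
            (fun α => ENNReal.ofReal (Real.sin α ^ m) * g (Real.cos α)) p.2 := by
        rw [polarCoord_target]
        refine setLIntegral_congr_fun (measurableSet_Ioi.prod measurableSet_Ioo) ?_
        rintro ⟨r, α⟩ ⟨hr, hα⟩
        simp only [mem_Ioi, mem_Ioo] at hr hα
        have hsq : √((r * Real.cos α) ^ 2 + (r * Real.sin α) ^ 2) = r := by
          rw [← Real.sqrt_sq hr.le]; congr 1
          rw [Real.sqrt_sq hr.le]
          linear_combination r ^ 2 * Real.cos_sq_add_sin_sq α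
        simp only [polarCoord_symm_apply, hF, indicator, mem_Ioi, mem_Ioo, smul_eq_mul]
        by_cases h0 : 0 < α
        · have hs : 0 < Real.sin α := Real.sin_pos_of_mem_Ioo ⟨h0, hα.2⟩
          rw [if_pos (mul_pos hr hs), if_pos ⟨h0, hα.2⟩, hsq, mul_div_cancel_left₀ _ hr.ne', mul_pow,
            ENNReal.ofReal_mul (by positivity), pow_succ, ENNReal.ofReal_mul (by positivity)]
          ring
        · have hs : Real.sin α ≤ 0 := Real.sin_nonpos_of_nonpos_of_neg_pi_le (not_lt.1 h0) hα.1.le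
          rw [if_neg (not_lt.2 (mul_nonpos_of_nonneg_of_nonpos hr.le hs)), if_neg (fun h => h0 h.1)]
          simp
    _ = _ := by
        rw [Measure.volume_eq_prod, ← Measure.prod_restrict, lintegral_prod_mul
          (f := fun r : ℝ => ENNReal.ofReal (r ^ (m + 1)) * φ r)
          (g := (Ioo 0 Real.pi).indicator
            (fun α => ENNReal.ofReal (Real.sin α ^ m) * g (Real.cos α)))]
        · congr 1
          rw [lintegral_indicator measurableSet_Ioo, Measure.restrict_restrict measurableSet_Ioo]
          congr 2
          refine inter_eq_left.2 (Ioo_subset_Ioo_left ?_)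
          linarith [Real.pi_pos]
        · fun_prop
        · exact (Measurable.indicator (by fun_prop) measurableSet_Ioo).aemeasurable

/-- Compute the same ball integral twice: directly in polar coordinates, and by splitting off the
first coordinate, using polar coordinates in the remaining `ℝ^m`, then in the meridian half-plane.
-/
lemma lintegral_surface_coord (m : ℕ) [NeZero m] {g : ℝ → ℝ≥0∞} (hg : Measurable g) :
    ∫⁻ x, g ((x : Vec (m + 1)) 0) ∂surface (m + 1) = surface m univ *
      ∫⁻ t in Ioo (-1 : ℝ) 1, ENNReal.ofReal ((1 - t ^ 2) ^ (((m : ℝ) - 2) / 2)) * g t := by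
  have hm : m - 1 + 1 = m := Nat.sub_add_cancel (NeZero.one_le)
  have hC : ENNReal.ofReal (1 / ((m + 1 - 1 : ℕ) + 1)) ≠ 0 := ofReal_one_div_succ_ne_zero _
  have key := lintegral_surface (k := m + 1) (g := fun x => g (x 0)) (by fun_prop)
  rw [← ENNReal.mul_left_inj hC ENNReal.ofReal_ne_top, ← key]
  have e1 := (measurePreserving_splitFirst m).lintegral_comp (f := fun p =>
    g (p.1 / √(p.1 ^ 2 + ‖p.2‖ ^ 2)) * ballWeight (√(p.1 ^ 2 + ‖p.2‖ ^ 2)))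
    (by have := measurable_ballWeight; fun_prop)
  simp only [splitFirst_fst, sqrt_splitFirst] at e1
  calc _ = ∫⁻ x : Vec (m + 1), g (x 0 / ‖x‖) * ballWeight ‖x‖ := by
        refine lintegral_congr fun x => ?_
        simp [div_eq_inv_mul]
    _ = _ := e1
    _ = ∫⁻ u, ∫⁻ y : Vec m, g (u / √(u ^ 2 + ‖y‖ ^ 2)) * ballWeight (√(u ^ 2 + ‖y‖ ^ 2)) := by
        rw [Measure.volume_eq_prod, lintegral_prod]
        have := measurable_ballWeight
        exact Measurable.aemeasurable (by fun_prop)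
    _ = ∫⁻ u, surface m univ * ∫⁻ s in Ioi (0 : ℝ), ENNReal.ofReal (s ^ (m - 1)) *
          (g (u / √(u ^ 2 + s ^ 2)) * ballWeight (√(u ^ 2 + s ^ 2))) := by
        refine lintegral_congr fun u => ?_
        have := lintegral_homogeneous_mul_norm (volume : Measure (Vec m)) (g := fun _ => 1)
          measurable_const (fun _ _ _ => rfl) (φ := fun s => g (u / √(u ^ 2 + s ^ 2)) *
            ballWeight (√(u ^ 2 + s ^ 2))) (by have := measurable_ballWeight; fun_prop)
        simpa [surface] using this
    _ = _ := by
        -- The half-plane formula at `m - 1` leaves the radial integral of `r ^ m` over the unit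
        -- interval, which is the normalizing constant `1 / (m + 1)` introduced above.
        rw [lintegral_const_mul', lintegral_upperHalfPlane _ hg measurable_ballWeight, hm,
          lintegral_pow_mul_ballWeight, ← lintegral_cos]
        · have : ((m - 1 : ℕ) : ℝ) - 1 = m - 2 := by
            rw [Nat.cast_sub NeZero.one_le]; push_cast; ring
          rw [this, Nat.add_sub_cancel]
          ring
        · exact measure_ne_top _ _

lemma exists_isometry_map {k : ℕ} {v w : Vec k} (h : ‖v‖ = ‖w‖) :
    ∃ L : Vec k ≃ₗᵢ[ℝ] Vec k, L v = w :=
  ⟨_, Submodule.reflection_sub h⟩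

lemma lintegral_surface_inner {k : ℕ} (hk : 2 ≤ k) {θ : Vec k} (hθ : ‖θ‖ = 1)
    {g : ℝ → ℝ≥0∞} (hg : Measurable g) :
    ∫⁻ x, g (inner ℝ (x : Vec k) θ) ∂surface k = surface (k - 1) univ *
      ∫⁻ t in Ioo (-1 : ℝ) 1, ENNReal.ofReal ((1 - t ^ 2) ^ (((k : ℝ) - 3) / 2)) * g t := by
  obtain ⟨m, rfl⟩ : ∃ m, k = m + 1 := ⟨k - 1, by omega⟩
  have : NeZero m := ⟨by omega⟩
  obtain ⟨L, hL⟩ := exists_isometry_map (v := θ) (w := EuclideanSpace.single 0 (1 : ℝ))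
    (by simp [hθ])
  have h1 : ∀ x : Vec (m + 1), inner ℝ x θ = L x 0 := fun x => by
    rw [← L.inner_map_map, hL, EuclideanSpace.inner_single_right]
    simp
  simp_rw [h1]
  rw [lintegral_surface_comp_isometry L (g := fun x : Vec (m + 1) => g (x 0)) (by fun_prop),
    lintegral_surface_coord m hg]
  rw [Nat.add_sub_cancel]
  congr! 7
  push_cast
  ring

lemma map_inner_surface {k : ℕ} (hk : 2 ≤ k) {θ : Vec k} (hθ : ‖θ‖ = 1) :
    (surface k).map (fun x : Sph k => inner ℝ (x : Vec k) θ) = surface (k - 1) univ •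
      (volume.restrict (Ioo (-1 : ℝ) 1)).withDensity
        fun t => ENNReal.ofReal ((1 - t ^ 2) ^ (((k : ℝ) - 3) / 2)) := by
  ext s hs
  have h := lintegral_surface_inner hk hθ (measurable_one.indicator hs)
  have hm : Measurable (fun x : Sph k => inner ℝ (x : Vec k) θ) := by fun_prop
  have h2 : (fun x : Sph k => s.indicator (1 : ℝ → ℝ≥0∞) (inner ℝ (x : Vec k) θ)) =
      ((fun x : Sph k => inner ℝ (x : Vec k) θ) ⁻¹' s).indicator 1 := rfl
  rw [h2, lintegral_indicator_one (hm hs)] at h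
  rw [Measure.map_apply hm hs, h, Measure.smul_apply, withDensity_apply _ hs, smul_eq_mul,
    ← lintegral_indicator hs]
  congr 2
  ext t
  simp [indicator]

/-! ### One-dimensional integrals against the projected weight. -/

/-- The total mass of the sphere of codimension one. -/
noncomputable def sliceConst (k : ℕ) : ℝ := (surface (k - 1)).real univ

lemma sliceConst_pos {k : ℕ} (hk : 2 ≤ k) : 0 < sliceConst k := by
  have : NeZero (k - 1) := ⟨by omega⟩
  exact measureReal_univ_pos

lemma integral_surface_inner {k : ℕ} (hk : 2 ≤ k) {θ : Vec k} (hθ : ‖θ‖ = 1)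
    {g : ℝ → ℝ} (hg : Continuous g) :
    ∫ x, g (inner ℝ (x : Vec k) θ) ∂surface k = sliceConst k *
      ∫ t in (-1 : ℝ)..1, g t * (1 - t ^ 2) ^ (((k : ℝ) - 3) / 2) := by
  have hm : Measurable (fun x : Sph k => inner ℝ (x : Vec k) θ) := by fun_prop
  rw [← integral_map (φ := fun x : Sph k => inner ℝ (x : Vec k) θ) hm.aemeasurable
    hg.measurable.aestronglyMeasurable, map_inner_surface hk hθ, integral_smul_measure,
    integral_withDensity_eq_integral_toReal_smul (by fun_prop) (by simp),
    intervalIntegral.integral_of_le (by norm_num), integral_Ioc_eq_integral_Ioo, smul_eq_mul]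
  congr 1
  refine setIntegral_congr_fun measurableSet_Ioo fun t ht => ?_
  have h0 : 0 ≤ 1 - t ^ 2 := by nlinarith [ht.1, ht.2]
  simp only [smul_eq_mul]
  rw [ENNReal.toReal_ofReal (Real.rpow_nonneg h0 _), mul_comm]

/-- For `k = 2` the weight is singular at `±1`. Its integral times the nonzero mass of the lower
sphere is the finite mass of the whole sphere, so it is finite. -/
lemma integrableOn_weight {k : ℕ} (hk : 2 ≤ k) :
    IntegrableOn (fun t : ℝ => (1 - t ^ 2) ^ (((k : ℝ) - 3) / 2)) (Ioo (-1) 1) := by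
  have : NeZero k := ⟨by omega⟩
  have : NeZero (k - 1) := ⟨by omega⟩
  refine ⟨Measurable.aestronglyMeasurable (by fun_prop), ?_⟩
  have h := lintegral_surface_inner hk (θ := EuclideanSpace.single 0 (1 : ℝ)) (by simp)
    (g := fun _ => 1) measurable_const
  simp only [lintegral_const, one_mul, mul_one] at h
  have hlt := measure_lt_top (surface k) univ
  rw [h, ENNReal.mul_lt_top_iff] at hlt
  have h0 : surface (k - 1) univ ≠ 0 := NeZero.ne _
  rw [hasFiniteIntegral_iff_ofReal]
  · rcases hlt with h1 | h1 | h1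
    · exact h1.2
    · exact absurd h1 h0
    · rw [h1]; exact ENNReal.zero_lt_top
  · refine (ae_restrict_mem measurableSet_Ioo).mono fun t ht => Real.rpow_nonneg ?_ _
    nlinarith [ht.1, ht.2]

lemma intervalIntegrable_weight {k : ℕ} (hk : 2 ≤ k) {g : ℝ → ℝ} (hg : Continuous g) :
    IntervalIntegrable (fun t : ℝ => g t * (1 - t ^ 2) ^ (((k : ℝ) - 3) / 2)) volume (-1) 1 := by
  refine IntervalIntegrable.continuousOn_mul ?_ hg.continuousOn
  rw [intervalIntegrable_iff_integrableOn_Ioo_of_le (by norm_num)]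
  exact integrableOn_weight hk

/-- Integration by parts for the weight `(1 - t²)^{(k-3)/2}`. -/
lemma integral_one_sub_sq_mul_exp {k : ℕ} (hk : 2 ≤ k) {κ : ℝ} (hκ : κ ≠ 0) :
    ∫ t in (-1 : ℝ)..1, ((1 - t ^ 2) * Real.exp (κ * t)) * (1 - t ^ 2) ^ (((k : ℝ) - 3) / 2) =
      ((k : ℝ) - 1) / κ *
        ∫ t in (-1 : ℝ)..1, (t * Real.exp (κ * t)) * (1 - t ^ 2) ^ (((k : ℝ) - 3) / 2) := by
  have hk' : (2 : ℝ) ≤ k := by exact_mod_cast hk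
  have hp : 0 < ((k : ℝ) - 1) / 2 := by linarith
  have hi1 := intervalIntegrable_weight hk (g := fun t => (1 - t ^ 2) * Real.exp (κ * t))
    (by fun_prop)
  have hi2 := intervalIntegrable_weight hk (g := fun t => t * Real.exp (κ * t)) (by fun_prop)
  have hd : ∀ t ∈ Ioo (-1 : ℝ) 1,
      HasDerivAt (fun t : ℝ => Real.exp (κ * t) * (1 - t ^ 2) ^ (((k : ℝ) - 1) / 2))
        (κ * (((1 - t ^ 2) * Real.exp (κ * t)) * (1 - t ^ 2) ^ (((k : ℝ) - 3) / 2)) -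
          ((k : ℝ) - 1) * ((t * Real.exp (κ * t)) * (1 - t ^ 2) ^ (((k : ℝ) - 3) / 2))) t := by
    intro t ht
    have h0 : 0 < 1 - t ^ 2 := by nlinarith [ht.1, ht.2]
    have h1 : HasDerivAt (fun t : ℝ => 1 - t ^ 2) (-(2 * t)) t := by
      simpa using (hasDerivAt_pow 2 t).const_sub 1
    have h2 := h1.rpow_const (p := ((k : ℝ) - 1) / 2) (Or.inl h0.ne')
    have h3 : HasDerivAt (fun t : ℝ => Real.exp (κ * t)) (Real.exp (κ * t) * κ) t := by
      simpa using ((hasDerivAt_id t).const_mul κ).exp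
    refine (h3.mul h2).congr_deriv ?_
    have e1 : (1 - t ^ 2) ^ (((k : ℝ) - 1) / 2) =
        (1 - t ^ 2) * (1 - t ^ 2) ^ (((k : ℝ) - 3) / 2) := by
      nth_rewrite 2 [← Real.rpow_one (1 - t ^ 2)]
      rw [← Real.rpow_add h0]
      congr 1
      ring
    have e2 : ((k : ℝ) - 1) / 2 - 1 = ((k : ℝ) - 3) / 2 := by ring
    rw [e1, e2]
    ring
  have hc : ContinuousOn (fun t : ℝ => Real.exp (κ * t) * (1 - t ^ 2) ^ (((k : ℝ) - 1) / 2))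
      (Icc (-1) 1) := by
    refine ContinuousOn.mul (by fun_prop) (ContinuousOn.rpow_const (by fun_prop) ?_)
    exact fun _ _ => Or.inr hp.le
  -- Differentiability is asked for only inside the interval, since for `k = 2` it fails at `±1`;
  -- the boundary terms vanish because the exponent `(k-1)/2` is positive.
  have hftc := intervalIntegral.integral_eq_sub_of_hasDerivAt_of_le (by norm_num) hc hd
    ((hi1.const_mul κ).sub (hi2.const_mul _))
  rw [intervalIntegral.integral_sub (hi1.const_mul κ) (hi2.const_mul _),
    intervalIntegral.integral_const_mul, intervalIntegral.integral_const_mul] at hftc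
  have hz : (0 : ℝ) ^ (((k : ℝ) - 1) / 2) = 0 := Real.zero_rpow hp.ne'
  norm_num [hz] at hftc
  rw [div_mul_eq_mul_div, eq_div_iff hκ]
  linarith

/-! ### First and second moments of the FvML law. -/

lemma norm_coe_sph {k : ℕ} (x : Sph k) : ‖(x : Vec k)‖ = 1 := by simp

lemma abs_inner_sph_le {k : ℕ} (x : Sph k) (v : Vec k) : |inner ℝ (x : Vec k) v| ≤ ‖v‖ := by
  simpa using abs_real_inner_le_norm (x : Vec k) v

lemma dist_eq_tilted {k : ℕ} (κ : ℝ) (θ : Vec k) :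
    dist κ θ = (surface k).tilted fun x => κ * inner ℝ (x : Vec k) θ := rfl

lemma integrable_of_continuous {k : ℕ} (μ : Measure (Sph k)) [IsFiniteMeasure μ] {f : Sph k → ℝ}
    (hf : Continuous f) : Integrable f μ :=
  hf.integrable_of_hasCompactSupport (HasCompactSupport.of_compactSpace _)

/-- The normalizing integral of the FvML density. -/
noncomputable def partitionFun {k : ℕ} (κ : ℝ) (θ : Vec k) : ℝ :=
  ∫ y : Sph k, Real.exp (κ * inner ℝ (y : Vec k) θ) ∂(surface k)

lemma partitionFun_pos {k : ℕ} [NeZero k] (κ : ℝ) (θ : Vec k) : 0 < partitionFun κ θ :=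
  integral_exp_pos (integrable_of_continuous _ (by fun_prop))

lemma integral_dist {k : ℕ} (κ : ℝ) (θ : Vec k) (f : Sph k → ℝ) :
    ∫ x, f x ∂dist κ θ =
      (∫ x : Sph k, Real.exp (κ * inner ℝ (x : Vec k) θ) * f x ∂surface k) / partitionFun κ θ := by
  rw [dist_eq_tilted, integral_tilted, ← integral_div]
  refine integral_congr_ae (.of_forall fun x => ?_)
  simp only [smul_eq_mul, partitionFun]
  ring

lemma integral_dist_inner {k : ℕ} (hk : 2 ≤ k) (κ : ℝ) {θ : Vec k} (hθ : ‖θ‖ = 1)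
    {g : ℝ → ℝ} (hg : Continuous g) :
    ∫ x, g (inner ℝ (x : Vec k) θ) ∂dist κ θ =
      (∫ t in (-1 : ℝ)..1, (g t * Real.exp (κ * t)) * (1 - t ^ 2) ^ (((k : ℝ) - 3) / 2)) /
        ∫ t in (-1 : ℝ)..1, Real.exp (κ * t) * (1 - t ^ 2) ^ (((k : ℝ) - 3) / 2) := by
  have h1 := integral_surface_inner hk hθ (g := fun t => g t * Real.exp (κ * t)) (by fun_prop)
  have h2 := integral_surface_inner hk hθ (g := fun t => Real.exp (κ * t)) (by fun_prop)
  rw [integral_dist, partitionFun, h2,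
    ← mul_div_mul_left (∫ t in (-1 : ℝ)..1, (g t * Real.exp (κ * t)) * _) _
      (sliceConst_pos hk).ne', ← h1]
  congr 1
  exact integral_congr_ae (.of_forall fun x => mul_comm _ _)

lemma integral_inner_location {k : ℕ} (hk : 2 ≤ k) (κ : ℝ) {θ : Vec k} (hθ : ‖θ‖ = 1) :
    ∫ x : Sph k, inner ℝ (x : Vec k) θ ∂dist κ θ = A k κ :=
  integral_dist_inner hk κ hθ (g := fun t => t) continuous_id

lemma J_eq_integral {k : ℕ} (hk : 2 ≤ k) (κ : ℝ) {θ : Vec k} (hθ : ‖θ‖ = 1) :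
    ∫ x : Sph k, (1 - inner ℝ (x : Vec k) θ ^ 2) ∂dist κ θ = J k κ := by
  rw [integral_dist_inner hk κ hθ (g := fun t => 1 - t ^ 2) (by fun_prop), J,
    ← intervalIntegral.integral_div]
  refine intervalIntegral.integral_congr fun t _ => ?_
  simp only [projDensity]
  ring

/-- This identity reconciles the two shapes of the Fisher blocks: the variance computation produces
`J`, whereas `fisherI` is written with `A`. -/
lemma J_eq_mul_A {k : ℕ} (hk : 2 ≤ k) {κ : ℝ} (hκ : κ ≠ 0) :
    J k κ = ((k : ℝ) - 1) / κ * A k κ := by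
  have : NeZero k := ⟨by omega⟩
  have hθ : ‖(EuclideanSpace.single 0 1 : Vec k)‖ = 1 := by simp
  rw [← J_eq_integral hk κ hθ, integral_dist_inner hk κ hθ (g := fun t => 1 - t ^ 2) (by fun_prop),
    integral_one_sub_sq_mul_exp hk hκ, mul_div_assoc, A]

/-- As a mean over the compact sphere, `A` is a quotient of parametric integrals of jointly
continuous functions, which avoids the endpoint singularity of the weight. -/
lemma continuous_A {k : ℕ} (hk : 2 ≤ k) : Continuous (A k) := by
  have : NeZero k := ⟨by omega⟩
  have hθ : ‖(EuclideanSpace.single 0 1 : Vec k)‖ = 1 := by simp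
  have h : A k = fun κ => _ := funext fun κ => (integral_inner_location hk κ hθ).symm
  rw [h]
  simp_rw [integral_dist]
  refine Continuous.div ?_ ?_ fun κ => (partitionFun_pos κ _).ne'
  · have := continuous_parametric_integral_of_continuous (μ := surface k) (s := univ)
      (f := fun (κ : ℝ) (x : Sph k) => Real.exp (κ * inner ℝ (x : Vec k) (EuclideanSpace.single 0 1))
        * inner ℝ (x : Vec k) (EuclideanSpace.single 0 1)) (by fun_prop) isCompact_univ
    simpa using this
  · have := continuous_parametric_integral_of_continuous (μ := surface k) (s := univ)
      (f := fun (κ : ℝ) (x : Sph k) =>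
        Real.exp (κ * inner ℝ (x : Vec k) (EuclideanSpace.single 0 1))) (by fun_prop) isCompact_univ
    simpa [partitionFun] using this

lemma integral_surface_comp_isometry {k : ℕ} [NeZero k] (L : Vec k ≃ₗᵢ[ℝ] Vec k)
    {f : Vec k → ℝ} (hf : Continuous f) :
    ∫ x : Sph k, f (L x) ∂surface k = ∫ x : Sph k, f x ∂surface k := by
  set ν : Measure (Vec k) := (surface k).map Subtype.val with hν
  have hinv : ν.map L = ν := by
    refine Measure.ext_of_lintegral _ fun g hg => ?_
    have hL := L.continuous.measurable
    rw [lintegral_map hg hL, hν, lintegral_map (f := fun x => g (L x)) (hg.comp hL)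
      measurable_subtype_coe, lintegral_map hg measurable_subtype_coe]
    exact lintegral_surface_comp_isometry L hg
  have h1 : ∫ x, f x ∂ν = ∫ x : Sph k, f x ∂surface k :=
    integral_map measurable_subtype_coe.aemeasurable hf.aestronglyMeasurable
  have h2 : ∫ x, f (L x) ∂ν = ∫ x : Sph k, f (L x) ∂surface k :=
    integral_map measurable_subtype_coe.aemeasurable (hf.comp L.continuous).aestronglyMeasurable
  rw [← h1, ← h2]
  nth_rewrite 2 [← hinv]
  rw [integral_map L.continuous.measurable.aemeasurable hf.aestronglyMeasurable]

lemma integral_dist_comp_isometry {k : ℕ} [NeZero k] (κ : ℝ) {θ : Vec k} {L : Vec k ≃ₗᵢ[ℝ] Vec k}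
    (hL : L θ = θ) {f : Vec k → ℝ} (hf : Continuous f) :
    ∫ x : Sph k, f (L x) ∂dist κ θ = ∫ x : Sph k, f x ∂dist κ θ := by
  rw [integral_dist, integral_dist, ← integral_surface_comp_isometry L
    (f := fun x => Real.exp (κ * inner ℝ x θ) * f x) (by fun_prop)]
  congr 2
  ext x
  nth_rewrite 1 [← L.inner_map_map, hL]
  rfl

/-- The reflection negating `v` fixes `θ`, hence preserves the law, while it changes the sign of the
integrand. -/
lemma integral_dist_eq_zero_of_odd {k : ℕ} [NeZero k] (κ : ℝ) {θ v : Vec k}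
    (hv : inner ℝ v θ = 0) {f : ℝ → ℝ → ℝ} (hf : Continuous f.uncurry)
    (hodd : ∀ a b, f (-a) b = -f a b) :
    ∫ x : Sph k, f (inner ℝ (x : Vec k) v) (inner ℝ (x : Vec k) θ) ∂dist κ θ = 0 := by
  set L := (ℝ ∙ v)ᗮ.reflection
  have hLv : L v = -v := Submodule.reflection_orthogonalComplement_singleton_eq_neg v
  have hLθ : L θ = θ := Submodule.reflection_mem_subspace_eq_self
    (Submodule.mem_orthogonal_singleton_iff_inner_right.2 hv)
  have h := integral_dist_comp_isometry κ hLθ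
    (f := fun x => f (inner ℝ x v) (inner ℝ x θ)) (by fun_prop)
  have e1 : ∀ x, inner ℝ (L x) v = -inner ℝ x v := fun x => by
    rw [← L.inner_map_map x v, hLv, inner_neg_right, neg_neg]
  have e2 : ∀ x, inner ℝ (L x) θ = inner ℝ x θ := fun x => by
    rw [← L.inner_map_map x θ, hLθ]
  simp only [e1, e2, hodd, integral_neg] at h
  linarith

/-- The reflection exchanging `v` and `w` fixes `θ`, which is orthogonal to `v - w`. -/
lemma integral_inner_sq_eq {k : ℕ} [NeZero k] (κ : ℝ) {θ v w : Vec k}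
    (hv : inner ℝ v θ = 0) (hw : inner ℝ w θ = 0) (hvw : ‖v‖ = ‖w‖) :
    ∫ x : Sph k, inner ℝ (x : Vec k) v ^ 2 ∂dist κ θ =
      ∫ x : Sph k, inner ℝ (x : Vec k) w ^ 2 ∂dist κ θ := by
  set L := (ℝ ∙ (v - w))ᗮ.reflection
  have hLv : L v = w := Submodule.reflection_sub hvw
  have hLθ : L θ = θ := Submodule.reflection_mem_subspace_eq_self
    (Submodule.mem_orthogonal_singleton_iff_inner_right.2 (by rw [inner_sub_left, hv, hw, sub_zero]))
  rw [← integral_dist_comp_isometry κ hLθ (f := fun x => inner ℝ x w ^ 2) (by fun_prop)]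
  simp_rw [← hLv, L.inner_map_map]

/-- Complete `θ` to an orthonormal basis. The squared coordinates along the other `k - 1` vectors
sum to `1 - (x'θ)²`, of mean `J`, and by symmetry they share it equally. -/
lemma integral_inner_sq {k : ℕ} [NeZero k] (hk : 2 ≤ k) (κ : ℝ) {θ v : Vec k} (hθ : ‖θ‖ = 1)
    (hv : inner ℝ v θ = 0) :
    ∫ x : Sph k, inner ℝ (x : Vec k) v ^ 2 ∂dist κ θ = J k κ / ((k : ℝ) - 1) * ‖v‖ ^ 2 := by
  have ho : Orthonormal ℝ (({0} : Set (Fin k)).domRestrict fun _ => θ) := by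
    rw [orthonormal_iff_ite]
    intro i j
    rw [if_pos (Subsingleton.elim i j)]
    simp [hθ]
  obtain ⟨b, hb⟩ := ho.exists_orthonormalBasis_extension_of_card_eq (by simp)
  have hb0 : b 0 = θ := hb 0 rfl
  have hsum : ∀ x : Sph k, 1 - inner ℝ (x : Vec k) θ ^ 2 =
      ∑ i ∈ Finset.univ.erase 0, inner ℝ (x : Vec k) (b i) ^ 2 := by
    intro x
    have h := b.sum_sq_inner_left (x : Vec k)
    rw [norm_coe_sph, ← Finset.add_sum_erase _ _ (Finset.mem_univ 0), hb0] at h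
    linarith
  have hJ := J_eq_integral hk κ hθ
  simp_rw [hsum] at hJ
  rw [integral_finsetSum _ fun i _ => integrable_of_continuous _ (by fun_prop)] at hJ
  have hi : ∀ i ∈ Finset.univ.erase (0 : Fin k),
      ‖v‖ ^ 2 * ∫ x : Sph k, inner ℝ (x : Vec k) (b i) ^ 2 ∂dist κ θ =
        ∫ x : Sph k, inner ℝ (x : Vec k) v ^ 2 ∂dist κ θ := by
    intro i hi
    have hbi : inner ℝ (b i) θ = 0 := by
      rw [← hb0]; exact b.orthonormal.2 (Finset.ne_of_mem_erase hi)
    rw [integral_inner_sq_eq κ hv (w := ‖v‖ • b i) (by rw [inner_smul_left, hbi, mul_zero])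
      (by simp [norm_smul]), ← integral_const_mul]
    simp_rw [inner_smul_right, mul_pow]
  have hk' : (2 : ℝ) ≤ k := by exact_mod_cast hk
  have hcard : ((Finset.univ.erase (0 : Fin k)).card : ℝ) = k - 1 := by
    rw [Finset.card_erase_of_mem (Finset.mem_univ _), Finset.card_univ, Fintype.card_fin,
      Nat.cast_sub (by omega), Nat.cast_one]
  have h2 := Finset.sum_congr rfl hi
  rw [← Finset.mul_sum, hJ, Finset.sum_const, nsmul_eq_mul, hcard] at h2
  have : (k : ℝ) - 1 ≠ 0 := by linarith
  field_simp
  linarith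

lemma integral_inner_mean {k : ℕ} [NeZero k] (hk : 2 ≤ k) (κ : ℝ) {θ : Vec k} (hθ : ‖θ‖ = 1)
    (h : Vec k) :
    ∫ x : Sph k, (inner ℝ (x : Vec k) h - inner ℝ h θ * A k κ) ∂dist κ θ = 0 := by
  set v := h - inner ℝ h θ • θ with hv
  have hvθ : inner ℝ v θ = 0 := by
    rw [hv, inner_sub_left, inner_smul_left, real_inner_self_eq_norm_sq, hθ]; simp
  have hh : h = inner ℝ h θ • θ + v := by rw [hv]; abel
  have e : ∀ x : Sph k, inner ℝ (x : Vec k) h =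
      inner ℝ h θ * inner ℝ (x : Vec k) θ + inner ℝ (x : Vec k) v := fun x => by
    nth_rewrite 1 [hh]; rw [inner_add_right, inner_smul_right]
  have h0 := integral_dist_eq_zero_of_odd κ hvθ (f := fun a _ => a) (by fun_prop) (by simp)
  rw [integral_sub (integrable_of_continuous _ (by fun_prop)) (integrable_const _)]
  simp_rw [e]
  rw [integral_add (integrable_of_continuous _ (by fun_prop))
    (integrable_of_continuous _ (by fun_prop)), integral_const_mul,
    integral_inner_location hk κ hθ, h0]
  simp

/-- The variance of `X'h` under the FvML distribution. -/
noncomputable def varForm {k : ℕ} (κ : ℝ) (θ h : Vec k) : ℝ :=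
  (1 - J k κ - A k κ ^ 2) * inner ℝ h θ ^ 2 +
    J k κ / ((k : ℝ) - 1) * (‖h‖ ^ 2 - inner ℝ h θ ^ 2)

lemma integral_inner_variance {k : ℕ} [NeZero k] (hk : 2 ≤ k) (κ : ℝ) {θ : Vec k} (hθ : ‖θ‖ = 1)
    (h : Vec k) :
    ∫ x : Sph k, (inner ℝ (x : Vec k) h - inner ℝ h θ * A k κ) ^ 2 ∂dist κ θ =
      varForm κ θ h := by
  set a := inner ℝ h θ with ha
  set v := h - a • θ with hv
  have hvθ : inner ℝ v θ = 0 := by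
    rw [hv, inner_sub_left, inner_smul_left, real_inner_self_eq_norm_sq, hθ, ← ha]; simp
  have hh : h = a • θ + v := by rw [hv]; abel
  have hn : ‖v‖ ^ 2 = ‖h‖ ^ 2 - a ^ 2 := by
    rw [hv, norm_sub_sq_real, inner_smul_right, norm_smul, hθ, ← ha, mul_one, Real.norm_eq_abs,
      sq_abs]
    ring
  -- Split `h` into its parts along and orthogonal to `θ`; the last two terms are odd in `v` and
  -- integrate to zero.
  have e : ∀ x : Sph k, (inner ℝ (x : Vec k) h - a * A k κ) ^ 2 =
      (a ^ 2 * (1 + A k κ ^ 2) + (-(a ^ 2) * (1 - inner ℝ (x : Vec k) θ ^ 2)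
        + (-(2 * a ^ 2 * A k κ)) * inner ℝ (x : Vec k) θ)) +
      (inner ℝ (x : Vec k) v ^ 2 +
      ((2 * a) * (inner ℝ (x : Vec k) v * inner ℝ (x : Vec k) θ) +
      (-(2 * a * A k κ)) * inner ℝ (x : Vec k) v)) := fun x => by
    have : inner ℝ (x : Vec k) h = a * inner ℝ (x : Vec k) θ + inner ℝ (x : Vec k) v := by
      nth_rewrite 1 [hh]; rw [inner_add_right, inner_smul_right]
    rw [this]
    ring
  have h0 := integral_dist_eq_zero_of_odd κ hvθ (f := fun a _ => a) (by fun_prop) (by simp)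
  have h1 := integral_dist_eq_zero_of_odd κ hvθ (f := fun a b => a * b) (by fun_prop) (by simp)
  have hi : ∀ {f : Sph k → ℝ}, Continuous f → Integrable f (dist κ θ) :=
    fun hf => integrable_of_continuous _ hf
  simp_rw [e]
  rw [integral_add (hi (by fun_prop)) (hi (by fun_prop)),
    integral_add (hi (by fun_prop)) (hi (by fun_prop)),
    integral_add (hi (by fun_prop)) (hi (by fun_prop)),
    integral_add (hi (by fun_prop)) (hi (by fun_prop)),
    integral_add (hi (by fun_prop)) (hi (by fun_prop)), integral_const_mul, integral_const_mul,
    integral_const_mul, integral_const_mul, integral_const_mul, h0, h1, J_eq_integral hk κ hθ,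
    integral_inner_location hk κ hθ, integral_inner_sq hk κ hθ hvθ, hn, varForm]
  simp
  ring

lemma varForm_nonneg {k : ℕ} [NeZero k] (hk : 2 ≤ k) (κ : ℝ) {θ : Vec k} (hθ : ‖θ‖ = 1)
    (h : Vec k) : 0 ≤ varForm κ θ h := by
  rw [← integral_inner_variance hk κ hθ]
  exact integral_nonneg fun _ => sq_nonneg _

/-! ### Fisher information and central sequence as variance and sum of scores. -/

/-- The direction in `ℝ^k` (the natural parameter space) of the perturbation `(c, t)` of
`(κ, θ)`. -/
noncomputable def tangent {k : ℕ} (κ : ℝ) (θ : Vec k) (c : ℝ) (t : Vec k) : Vec k :=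
  c • θ + κ • (t - inner ℝ t θ • θ)

lemma inner_tangent {k : ℕ} (κ : ℝ) {θ : Vec k} (hθ : ‖θ‖ = 1) (c : ℝ) (t : Vec k) :
    inner ℝ (tangent κ θ c t) θ = c := by
  simp [tangent, inner_add_left, inner_smul_left, inner_sub_left, hθ]

lemma norm_tangent_sq {k : ℕ} (κ : ℝ) {θ : Vec k} (hθ : ‖θ‖ = 1) (c : ℝ) (t : Vec k) :
    ‖tangent κ θ c t‖ ^ 2 = c ^ 2 + κ ^ 2 * (‖t‖ ^ 2 - inner ℝ t θ ^ 2) := by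
  rw [tangent, norm_add_sq_real, norm_smul, norm_smul, mul_pow, mul_pow, norm_sub_sq_real,
    norm_smul, hθ]
  simp [inner_smul_left, inner_smul_right, inner_sub_right, hθ,
    real_inner_comm]
  ring

lemma inner_stack {k : ℕ} (c d : ℝ) (s t : Vec k) :
    inner ℝ (stack c s) (stack d t) = c * d + inner ℝ s t := by
  simp [stack, PiLp.inner_apply, Fintype.sum_sum_type, mul_comm]

/-- The Fisher form is the variance of `X'h` for `h` the tangent direction: `c` is its component
along `θ`, and the projection `I - θθ'` measures the orthogonal part. -/
lemma stack_dotProduct_fisher {k : ℕ} (hk : 2 ≤ k) {κ : ℝ} (hκ : κ ≠ 0) {θ : Vec k}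
    (hθ : ‖θ‖ = 1) (c : ℝ) (t : Vec k) :
    (stack c t).ofLp ⬝ᵥ (fisher κ θ).mulVec (stack c t).ofLp = varForm κ θ (tangent κ θ c t) := by
  have h1 : (stack c t).ofLp = Sum.elim (fun _ => c) t.ofLp := rfl
  have h2 : t.ofLp ⬝ᵥ t.ofLp = ‖t‖ ^ 2 := by
    rw [EuclideanSpace.real_norm_sq_eq]
    simp [dotProduct, sq]
  have h3 : t.ofLp ⬝ᵥ θ.ofLp = inner ℝ t θ := by
    simp [PiLp.inner_apply, dotProduct, mul_comm]
  rw [h1, fisher, Matrix.fromBlocks_mulVec, Sum.elim_comp_inl, Sum.elim_comp_inr,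
    sumElim_dotProduct_sumElim, varForm, inner_tangent κ hθ, norm_tangent_sq κ hθ, fisherII,
    fisherI, ← J_eq_mul_A hk hκ, Matrix.smul_mulVec, Matrix.sub_mulVec, Matrix.one_mulVec,
    Matrix.vecMulVec_mulVec]
  have h4 : ∀ a : ℝ, (fun _ : Fin 1 => c) ⬝ᵥ
      (Matrix.of fun _ _ : Fin 1 => a).mulVec (fun _ => c) = a * c ^ 2 := fun a => by
    simp [dotProduct, Matrix.mulVec]; ring
  simp [dotProduct_sub, h2, h3, h4, dotProduct_comm θ.ofLp t.ofLp]
  ring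

lemma posSemidef_fisher {k : ℕ} [NeZero k] (hk : 2 ≤ k) {κ : ℝ} (hκ : κ ≠ 0) {θ : Vec k}
    (hθ : ‖θ‖ = 1) : (fisher κ θ).PosSemidef := by
  refine Matrix.PosSemidef.of_dotProduct_mulVec_nonneg ?_ fun x => ?_
  · refine Matrix.IsHermitian.fromBlocks ?_ (by simp) ?_
    · ext i j; simp
    · ext i j
      simp [fisherII, Matrix.vecMulVec_apply, Matrix.one_apply, mul_comm, eq_comm]
  · have : x = (stack (x (Sum.inl 0)) (WithLp.toLp 2 fun i => x (Sum.inr i))).ofLp := by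
      ext i
      rcases i with i | i
      · rw [Subsingleton.elim i 0]; rfl
      · rfl
    rw [star_trivial, this, stack_dotProduct_fisher hk hκ hθ]
    exact varForm_nonneg hk κ hθ _

/-- The square root is the length of the component orthogonal to `θ`, so it undoes the normalization
in `sgn`; when that component vanishes both sides are zero. -/
lemma sqrt_smul_sgn {k : ℕ} {θ : Vec k} (hθ : ‖θ‖ = 1) (x : Sph k) :
    √(1 - inner ℝ (x : Vec k) θ ^ 2) • sgn θ (x : Vec k) =
      (x : Vec k) - inner ℝ (x : Vec k) θ • θ := by
  have h : 1 - inner ℝ (x : Vec k) θ ^ 2 = ‖(x : Vec k) - inner ℝ (x : Vec k) θ • θ‖ ^ 2 := by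
    rw [norm_sub_sq_real, inner_smul_right, norm_smul, hθ, norm_coe_sph, mul_one,
      Real.norm_eq_abs, sq_abs]
    ring
  rw [h, Real.sqrt_sq (norm_nonneg _), sgn, smul_smul]
  by_cases h0 : (x : Vec k) - inner ℝ (x : Vec k) θ • θ = 0
  · simp [h0]
  · rw [mul_inv_cancel₀ (norm_ne_zero_iff.2 h0), one_smul]

lemma inner_stack_central {k : ℕ} (n : ℕ) (κ : ℝ) {θ : Vec k} (hθ : ‖θ‖ = 1) (c : ℝ) (t : Vec k)
    (x : Fin n → Sph k) :
    inner ℝ (stack c t) (central n κ θ x) = (√n)⁻¹ *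
      ∑ i, (inner ℝ (x i : Vec k) (tangent κ θ c t) -
        inner ℝ (tangent κ θ c t) θ * A k κ) := by
  rw [central, inner_stack, centralI, centralII, inner_tangent κ hθ]
  simp_rw [sqrt_smul_sgn hθ]
  rw [inner_smul_right, inner_sum, mul_comm κ, mul_assoc, mul_left_comm, ← mul_add,
    Finset.mul_sum, Finset.mul_sum, ← Finset.sum_add_distrib]
  congr 1
  refine Finset.sum_congr rfl fun i _ => ?_
  simp only [tangent, inner_add_right, inner_smul_right, inner_sub_right,
    real_inner_comm t]
  rw [real_inner_comm θ t]
  ring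

/-! ### Taylor expansions for bounded centred variables. -/

lemma norm_exp_sub_quadratic_le {z : ℂ} (hz : ‖z‖ ≤ 1) :
    ‖Complex.exp z - 1 - z - z ^ 2 / 2‖ ≤ ‖z‖ ^ 3 := by
  have h := Complex.exp_bound hz (n := 3) (by norm_num)
  simp only [Finset.sum_range_succ, Finset.sum_range_zero] at h
  norm_num [Nat.factorial] at h
  have h3 : 0 ≤ ‖z‖ ^ 3 := by positivity
  calc _ = ‖Complex.exp z - (1 + z + z ^ 2 / 2)‖ := by ring_nf
    _ ≤ _ := by linarith

/-- Second-order expansion of the Laplace transform of a bounded centred variable. -/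
lemma norm_integral_exp_sub_quadratic_le {Ω : Type*} [MeasurableSpace Ω] {μ : Measure Ω}
    [IsProbabilityMeasure μ] {Y : Ω → ℝ} (hY : Measurable Y) {b : ℝ} (hb : ∀ ω, |Y ω| ≤ b)
    (hmean : ∫ ω, Y ω ∂μ = 0) {z : ℂ} (hz : ‖z‖ * b ≤ 1) :
    ‖∫ ω, Complex.exp (z * Y ω) ∂μ - 1 - z ^ 2 / 2 * ∫ ω, (Y ω) ^ 2 ∂μ‖ ≤ (‖z‖ * b) ^ 3 := by
  have hnorm : ∀ ω, ‖z * Y ω‖ ≤ ‖z‖ * b := fun ω => by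
    rw [norm_mul, Complex.norm_real, Real.norm_eq_abs]
    exact mul_le_mul_of_nonneg_left (hb ω) (norm_nonneg _)
  have hi1 : Integrable (fun ω => Complex.exp (z * Y ω)) μ := by
    refine Integrable.of_bound (Measurable.aestronglyMeasurable (by fun_prop)) (Real.exp 1)
      (.of_forall fun ω => ?_)
    rw [Complex.norm_exp]
    exact Real.exp_le_exp.2 ((Complex.re_le_norm _).trans ((hnorm ω).trans hz))
  have hi2 : Integrable (fun ω => z * (Y ω : ℂ)) μ :=
    Integrable.of_bound (Measurable.aestronglyMeasurable (by fun_prop)) _ (.of_forall hnorm)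
  have hi3 : Integrable (fun ω => (z * (Y ω : ℂ)) ^ 2 / 2) μ := by
    refine Integrable.of_bound (Measurable.aestronglyMeasurable (by fun_prop)) ((‖z‖ * b) ^ 2 / 2)
      (.of_forall fun ω => ?_)
    rw [norm_div, norm_pow, Complex.norm_ofNat]
    gcongr
    exact hnorm ω
  have e1 : ∫ ω, z * (Y ω : ℂ) ∂μ = 0 := by
    rw [integral_const_mul, integral_complex_ofReal, hmean]; simp
  have e2 : ∫ ω, (z * (Y ω : ℂ)) ^ 2 / 2 ∂μ = z ^ 2 / 2 * ((∫ ω, (Y ω) ^ 2 ∂μ : ℝ) : ℂ) := by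
    rw [← integral_complex_ofReal, ← integral_const_mul]
    refine integral_congr_ae (.of_forall fun ω => ?_)
    push_cast
    ring
  have e : ∫ ω, Complex.exp (z * Y ω) ∂μ - 1 - z ^ 2 / 2 * ((∫ ω, (Y ω) ^ 2 ∂μ : ℝ) : ℂ) =
      ∫ ω, (Complex.exp (z * Y ω) - 1 - z * Y ω - (z * Y ω) ^ 2 / 2) ∂μ := by
    have hi4 : Integrable (fun ω => Complex.exp (z * Y ω) - 1) μ := hi1.sub (integrable_const _)
    have hi5 : Integrable (fun ω => Complex.exp (z * Y ω) - 1 - z * Y ω) μ := hi4.sub hi2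
    rw [integral_sub hi5 hi3, integral_sub hi4 hi2, integral_sub hi1 (integrable_const _), e1, e2]
    simp
  rw [e]
  have := norm_integral_le_of_norm_le_const (μ := μ) (C := (‖z‖ * b) ^ 3)
    (f := fun ω => Complex.exp (z * Y ω) - 1 - z * Y ω - (z * Y ω) ^ 2 / 2)
    (.of_forall fun ω => (norm_exp_sub_quadratic_le ((hnorm ω).trans hz)).trans (by
      gcongr; exact hnorm ω))
  simpa using this

/-- Second-order expansion of the cumulant generating function of a bounded centred variable. -/
lemma abs_log_integral_exp_sub_le {Ω : Type*} [MeasurableSpace Ω] {μ : Measure Ω}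
    [IsProbabilityMeasure μ] {Y : Ω → ℝ} (hY : Measurable Y) {b : ℝ} (hb : ∀ ω, |Y ω| ≤ b)
    (hmean : ∫ ω, Y ω ∂μ = 0) (hb2 : b ≤ 1 / 2) :
    |Real.log (∫ ω, Real.exp (Y ω) ∂μ) - (∫ ω, (Y ω) ^ 2 ∂μ) / 2| ≤ 9 * b ^ 3 := by
  obtain ⟨ω₀⟩ : Nonempty Ω := nonempty_of_isProbabilityMeasure μ
  have hb0 : 0 ≤ b := (abs_nonneg _).trans (hb ω₀)
  have h := norm_integral_exp_sub_quadratic_le hY hb hmean (z := 1) (by simp; linarith)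
  set v := ∫ ω, (Y ω) ^ 2 ∂μ with hv
  set e := ∫ ω, Real.exp (Y ω) ∂μ with he
  have hE : |e - 1 - v / 2| ≤ b ^ 3 := by
    have e1 : ∫ ω, Complex.exp (1 * Y ω) ∂μ = (e : ℂ) := by
      rw [he, ← integral_complex_ofReal]
      refine integral_congr_ae (.of_forall fun ω => ?_)
      simp
    rw [e1, norm_one, one_mul] at h
    rw [← Real.norm_eq_abs, ← Complex.norm_real]
    convert h using 2
    push_cast
    ring
  have hv0 : 0 ≤ v := integral_nonneg fun _ => sq_nonneg _
  have hvb : v ≤ b ^ 2 := by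
    have := norm_integral_le_of_norm_le_const (μ := μ) (C := b ^ 2) (f := fun ω => (Y ω) ^ 2)
      (.of_forall fun ω => by
        rw [norm_pow, Real.norm_eq_abs]; exact pow_le_pow_left₀ (abs_nonneg _) (hb ω) 2)
    rw [← hv, Real.norm_of_nonneg hv0] at this
    simpa using this
  have hb3 : b ^ 3 ≤ b ^ 2 / 2 := by nlinarith [sq_nonneg b]
  have hx : |1 - e| ≤ b ^ 2 := by
    rw [abs_le] at hE ⊢
    constructor <;> nlinarith
  have hb2' : b ^ 2 ≤ 1 / 4 := by nlinarith
  -- One term of the logarithm series at `1 - e`. Since `|1 - e| ≤ b² ≤ 1/4`, the error is at most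
  -- `2 b⁴ ≤ b³`; with the error `b³` in `hE`, the constant 9 is ample.
  have hl := Real.abs_log_sub_add_sum_range_le (x := 1 - e) (by linarith) 1
  simp only [Finset.sum_range_succ, Finset.sum_range_zero] at hl
  norm_num at hl
  have hl2 : |1 - e| ^ 2 / (1 - |1 - e|) ≤ 2 * (b ^ 2) ^ 2 := by
    rw [div_le_iff₀ (by linarith)]
    have : |1 - e| ^ 2 ≤ (b ^ 2) ^ 2 := pow_le_pow_left₀ (abs_nonneg _) hx 2
    nlinarith [sq_nonneg (b ^ 2)]
  have hb4 : 2 * (b ^ 2) ^ 2 ≤ b ^ 3 := by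
    have : 0 ≤ b ^ 3 := by positivity
    nlinarith
  rw [← sq_abs] at hl
  have h4 : |1 - e + Real.log e| ≤ b ^ 3 := hl.trans (hl2.trans hb4)
  have : 0 ≤ b ^ 3 := by positivity
  rw [abs_le] at h4 hE ⊢
  constructor <;> linarith

/-! ### Scores and the exact log-likelihood ratio. -/

/-- The centred projection of an observation on the direction `h`. -/
noncomputable def score {k : ℕ} (κ : ℝ) (θ h : Vec k) (x : Sph k) : ℝ :=
  inner ℝ (x : Vec k) h - inner ℝ h θ * A k κ

lemma continuous_score {k : ℕ} (κ : ℝ) (θ h : Vec k) : Continuous (score κ θ h) := by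
  unfold score; fun_prop

lemma integral_score {k : ℕ} [NeZero k] (hk : 2 ≤ k) (κ : ℝ) {θ : Vec k} (hθ : ‖θ‖ = 1)
    (h : Vec k) : ∫ x, score κ θ h x ∂dist κ θ = 0 :=
  integral_inner_mean hk κ hθ h

lemma integral_score_sq {k : ℕ} [NeZero k] (hk : 2 ≤ k) (κ : ℝ) {θ : Vec k} (hθ : ‖θ‖ = 1)
    (h : Vec k) : ∫ x, score κ θ h x ^ 2 ∂dist κ θ = varForm κ θ h :=
  integral_inner_variance hk κ hθ h

lemma abs_A_le {k : ℕ} (hk : 2 ≤ k) (κ : ℝ) : |A k κ| ≤ 1 := by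
  have : NeZero k := ⟨by omega⟩
  have hθ : ‖(EuclideanSpace.single 0 1 : Vec k)‖ = 1 := by simp
  rw [← integral_inner_location hk κ hθ, ← Real.norm_eq_abs]
  have := norm_integral_le_of_norm_le_const (μ := dist κ (EuclideanSpace.single 0 1 : Vec k))
    (C := 1) (f := fun x : Sph k => inner ℝ (x : Vec k) (EuclideanSpace.single 0 1))
    (.of_forall fun x => (abs_inner_sph_le x _).trans hθ.le)
  simpa using this

/-- A bound free of `κ` and `θ`: this is what makes the later expansions uniform along moving
parameters. -/
lemma abs_score_le {k : ℕ} (hk : 2 ≤ k) (κ : ℝ) {θ : Vec k} (hθ : ‖θ‖ = 1) (h : Vec k)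
    (x : Sph k) : |score κ θ h x| ≤ 2 * ‖h‖ := by
  have h1 := abs_inner_sph_le x h
  have h2 : |inner ℝ h θ * A k κ| ≤ ‖h‖ := by
    rw [abs_mul]
    have := abs_real_inner_le_norm h θ
    rw [hθ, mul_one] at this
    calc _ ≤ ‖h‖ * 1 := by gcongr; exact abs_A_le hk κ
      _ = _ := mul_one _
  rw [score]
  exact (abs_sub _ _).trans (by linarith)

lemma score_add {k : ℕ} (κ : ℝ) (θ h h' : Vec k) (x : Sph k) :
    score κ θ (h + h') x = score κ θ h x + score κ θ h' x := by
  simp only [score, inner_add_right, inner_add_left]; ring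

lemma score_smul {k : ℕ} (κ : ℝ) (θ h : Vec k) (a : ℝ) (x : Sph k) :
    score κ θ (a • h) x = a * score κ θ h x := by
  simp only [score, inner_smul_right, real_inner_smul_left]; ring

lemma varForm_smul {k : ℕ} (κ : ℝ) (θ h : Vec k) (a : ℝ) :
    varForm κ θ (a • h) = a ^ 2 * varForm κ θ h := by
  simp only [varForm, real_inner_smul_left, norm_smul, mul_pow, Real.norm_eq_abs, sq_abs]; ring

lemma tendsto_varForm {k : ℕ} (hk : 2 ≤ k) {ι : Type*} {l : Filter ι} {κs : ι → ℝ}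
    {θs hs : ι → Vec k} {κ : ℝ} {θ h : Vec k} (hκ : κ ≠ 0) (h1 : Tendsto κs l (𝓝 κ))
    (h2 : Tendsto θs l (𝓝 θ)) (h3 : Tendsto hs l (𝓝 h)) :
    Tendsto (fun i => varForm (κs i) (θs i) (hs i)) l (𝓝 (varForm κ θ h)) := by
  have hA : Tendsto (fun i => A k (κs i)) l (𝓝 (A k κ)) := ((continuous_A hk).tendsto κ).comp h1
  -- Continuity of `J` is inherited from `A` through integration by parts, which is why `κ ≠ 0`
  -- enters.
  have hJ : Tendsto (fun i => J k (κs i)) l (𝓝 (J k κ)) := by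
    rw [J_eq_mul_A hk hκ]
    refine ((tendsto_const_nhds.div h1 hκ).mul hA).congr' ?_
    filter_upwards [h1.eventually_ne hκ] with i hi
    rw [J_eq_mul_A hk hi]
    rfl
  have hin := h3.inner (𝕜 := ℝ) h2
  exact (((tendsto_const_nhds.sub hJ).sub (hA.pow 2)).mul (hin.pow 2)).add
    ((hJ.div_const _).mul ((h3.norm.pow 2).sub (hin.pow 2)))

lemma pi_withDensity {ι α : Type*} [Fintype ι] [MeasurableSpace α] (μ : Measure α)
    [IsProbabilityMeasure μ] {f : α → ℝ≥0∞} (hf : Measurable f) [SigmaFinite (μ.withDensity f)] :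
    Measure.pi (fun _ : ι => μ.withDensity f) =
      (Measure.pi fun _ : ι => μ).withDensity fun x => ∏ i, f (x i) := by
  refine Measure.pi_eq fun s hs => ?_
  have hms := MeasurableSet.univ_pi hs
  rw [withDensity_apply _ hms, ← lintegral_indicator hms]
  have e : (univ.pi s).indicator (fun x : ι → α => ∏ i, f (x i)) =
      fun x => ∏ i, (s i).indicator f (x i) := by
    ext x
    by_cases hx : x ∈ univ.pi s
    · rw [indicator_of_mem hx]
      exact Finset.prod_congr rfl fun i _ => (indicator_of_mem (hx i (mem_univ i)) f).symm
    · rw [indicator_of_notMem hx]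
      simp only [mem_univ_pi, not_forall] at hx
      obtain ⟨i, hi⟩ := hx
      exact (Finset.prod_eq_zero (Finset.mem_univ i) (indicator_of_notMem hi f)).symm
  rw [e, lintegral_prod_eq_prod_lintegral_of_indepFun _ _
    (iIndepFun_pi (μ := fun _ : ι => μ) (X := fun i => (s i).indicator f)
      fun i => (hf.indicator (hs i)).aemeasurable)
    fun i => (hf.indicator (hs i)).comp (measurable_pi_apply i)]
  refine Finset.prod_congr rfl fun i _ => ?_
  rw [(measurePreserving_eval (fun _ : ι => μ) i).lintegral_comp (hf.indicator (hs i)),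
    lintegral_indicator (hs i), withDensity_apply _ (hs i)]

lemma dist_eq_tilted_dist {k : ℕ} (κ κ' : ℝ) (θ θ' : Vec k) :
    dist κ' θ' = (dist κ θ).tilted fun x => inner ℝ (x : Vec k) (κ' • θ' - κ • θ) := by
  rw [dist_eq_tilted, dist_eq_tilted,
    tilted_tilted (integrable_of_continuous _ (by fun_prop))]
  congr 1
  ext x
  simp only [Pi.add_apply, inner_sub_right, inner_smul_right]
  ring

/-- The density of one tilt with respect to another is `exp (x'δ) / Z`. Centring `x'δ` shifts both
the sum and the log-normalizer by `n * a`, so the shifts cancel. -/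
lemma logLR_ae_eq {k : ℕ} [NeZero k] (n : ℕ) (κ κ' : ℝ) (θ θ' : Vec k) :
    ∀ᵐ x ∂joint n κ θ, logLR n κ' θ' κ θ x =
      ∑ i, score κ θ (κ' • θ' - κ • θ) (x i) -
        n * Real.log (∫ y, Real.exp (score κ θ (κ' • θ' - κ • θ) y) ∂dist κ θ) := by
  set δ := κ' • θ' - κ • θ with hδ
  set a := inner ℝ δ θ * A k κ with ha
  set Z := ∫ y : Sph k, Real.exp (inner ℝ (y : Vec k) δ) ∂dist κ θ with hZ
  have hZpos : 0 < Z := integral_exp_pos (integrable_of_continuous _ (by fun_prop))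
  set f : Sph k → ℝ≥0∞ := fun x => ENNReal.ofReal (Real.exp (inner ℝ (x : Vec k) δ) / Z) with hf
  have hfm : Measurable f := by fun_prop
  have hd : dist κ' θ' = (dist κ θ).withDensity f := dist_eq_tilted_dist κ κ' θ θ'
  have : SigmaFinite ((dist κ θ).withDensity f) := by rw [← hd]; infer_instance
  have hj : joint n κ' θ' = (joint n κ θ).withDensity fun x => ∏ i, f (x i) := by
    rw [joint, hd, pi_withDensity _ hfm, joint]
  have hrn := rnDeriv_withDensity (joint n κ θ) (f := fun x => ∏ i, f (x i)) (by fun_prop)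
  rw [← hj] at hrn
  have hZ' : ∫ y, Real.exp (score κ θ δ y) ∂dist κ θ = Z * Real.exp (-a) := by
    rw [hZ, ← integral_mul_const]
    refine integral_congr_ae (.of_forall fun y => ?_)
    simp only [score]
    rw [← Real.exp_add]
    rfl
  filter_upwards [hrn] with x hx
  rw [logLR, hx, ENNReal.toReal_prod, hZ', Real.log_mul hZpos.ne' (Real.exp_ne_zero _),
    Real.log_exp, Real.log_prod]
  · have : ∀ i, Real.log (f (x i)).toReal = score κ θ δ (x i) + a - Real.log Z := fun i => by
      rw [hf]
      simp only
      rw [ENNReal.toReal_ofReal (by positivity), Real.log_div (Real.exp_ne_zero _) hZpos.ne',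
        Real.log_exp, score]
      ring
    simp only [this, Finset.sum_sub_distrib, Finset.sum_add_distrib]
    simp
    ring
  · intro i _
    rw [hf]
    simp only
    rw [ENNReal.toReal_ofReal (by positivity)]
    positivity

/-- Chebyshev's inequality: by independence the normalized sum of centred scores has variance
exactly `varForm κ θ h`. The factor `n^{-1/2}` is absorbed into the direction by linearity. -/
lemma joint_sum_score_ge_le {k : ℕ} [NeZero k] (hk : 2 ≤ k) {n : ℕ} (hn : 1 ≤ n) (κ : ℝ)
    {θ : Vec k} (hθ : ‖θ‖ = 1) (h : Vec k) {ε : ℝ} (hε : 0 < ε) :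
    joint n κ θ {x | ε ≤ |(√n)⁻¹ * ∑ i, score κ θ h (x i)|} ≤
      ENNReal.ofReal (varForm κ θ h / ε ^ 2) := by
  have hmem : ∀ h', MemLp (score κ θ h') 2 (dist κ θ) := fun h' =>
    MemLp.of_bound (continuous_score κ θ h').measurable.aestronglyMeasurable _
      (.of_forall fun x => abs_score_le hk κ hθ h' x)
  have hmean := integral_score hk κ hθ ((√n)⁻¹ • h)
  have hvar : Var[score κ θ ((√n)⁻¹ • h); dist κ θ] = (n : ℝ)⁻¹ * varForm κ θ h := by
    rw [variance_of_integral_eq_zero (continuous_score κ θ _).measurable.aemeasurable hmean,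
      integral_score_sq hk κ hθ, varForm_smul, inv_pow, Real.sq_sqrt (Nat.cast_nonneg n)]
  have hs : ∀ x : Fin n → Sph k, (√n)⁻¹ * ∑ i, score κ θ h (x i) =
      (∑ i, fun x : Fin n → Sph k => score κ θ ((√n)⁻¹ • h) (x i)) x := fun x => by
    simp only [Finset.sum_apply, score_smul, Finset.mul_sum]
  have hmemi : ∀ i : Fin n, MemLp (fun x : Fin n → Sph k => score κ θ ((√n)⁻¹ • h) (x i)) 2
      (joint n κ θ) := fun i =>
    (hmem _).comp_measurePreserving (measurePreserving_eval (fun _ : Fin n => dist κ θ) i)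
  have hcheb := meas_ge_le_variance_div_sq (memLp_finsetSum' Finset.univ fun i _ => hmemi i) hε
  have h0 : ∫ x, (∑ i, fun x : Fin n → Sph k => score κ θ ((√n)⁻¹ • h) (x i)) x
      ∂joint n κ θ = 0 := by
    simp only [Finset.sum_apply]
    rw [integral_finsetSum _ fun i _ => (hmemi i).integrable (by norm_num)]
    refine Finset.sum_eq_zero fun i _ => ?_
    rw [joint, integral_comp_eval (μ := fun _ : Fin n => dist κ θ)
      (f := score κ θ ((√n)⁻¹ • h)) (continuous_score κ θ _).measurable.aestronglyMeasurable]
    exact hmean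
  rw [h0] at hcheb
  simp only [sub_zero, ← hs] at hcheb
  refine hcheb.trans_eq ?_
  have := variance_sum_pi (μ := fun _ : Fin n => dist κ θ)
    (X := fun _ => score κ θ ((√n)⁻¹ • h)) fun _ => hmem _
  rw [joint, this, Finset.sum_const, hvar]
  have : (n : ℝ) ≠ 0 := by positivity
  simp [this]

/-! ### Local parametrization and limits along parameter sequences. -/

lemma tendsto_inv_sqrt_nat : Tendsto (fun n : ℕ => (√(n : ℝ))⁻¹) atTop (𝓝 0) :=
  tendsto_inv_atTop_zero.comp (Real.tendsto_sqrt_atTop.comp tendsto_natCast_atTop_atTop)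

lemma tendsto_tangent {k : ℕ} {ι : Type*} {l : Filter ι} {κs c : ι → ℝ} {θs t : ι → Vec k}
    {κ c₀ : ℝ} {θ t₀ : Vec k} (h1 : Tendsto κs l (𝓝 κ)) (h2 : Tendsto θs l (𝓝 θ))
    (h3 : Tendsto c l (𝓝 c₀)) (h4 : Tendsto t l (𝓝 t₀)) :
    Tendsto (fun i => tangent (κs i) (θs i) (c i) (t i)) l (𝓝 (tangent κ θ c₀ t₀)) :=
  (h3.smul h2).add (h1.smul (h4.sub ((h4.inner h2).smul h2)))

/-- The second-order part of the perturbation of the natural parameter `κ θ`. -/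
noncomputable def curvature {k : ℕ} (κ : ℝ) (θ : Vec k) (c : ℝ) (t : Vec k) : Vec k :=
  c • t - (κ * ‖t‖ ^ 2 / 2) • θ

lemma tendsto_curvature {k : ℕ} {ι : Type*} {l : Filter ι} {κs c : ι → ℝ} {θs t : ι → Vec k}
    {κ c₀ : ℝ} {θ t₀ : Vec k} (h1 : Tendsto κs l (𝓝 κ)) (h2 : Tendsto θs l (𝓝 θ))
    (h3 : Tendsto c l (𝓝 c₀)) (h4 : Tendsto t l (𝓝 t₀)) :
    Tendsto (fun i => curvature (κs i) (θs i) (c i) (t i)) l (𝓝 (curvature κ θ c₀ t₀)) :=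
  (h3.smul h4).sub (((h1.mul (h4.norm.pow 2)).div_const 2).smul h2)

/-- That both `θ` and `θ + s • t` are unit vectors forces `t'θ = -s ‖t‖² / 2`. So the component of
`t` along `θ`, removed in `tangent`, is of order `s` and goes into `curvature`. -/
lemma naturalParameter_sub {k : ℕ} (κ : ℝ) {θ : Vec k} (hθ : ‖θ‖ = 1) (c : ℝ) {t : Vec k} {s : ℝ}
    (hs : s ≠ 0) (hst : ‖θ + s • t‖ = 1) :
    (κ + s * c) • (θ + s • t) - κ • θ =
      s • (tangent κ θ c t + s • curvature κ θ c t) := by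
  have h : inner ℝ t θ = -(s * ‖t‖ ^ 2 / 2) := by
    have h1 := norm_add_sq_real θ (s • t)
    rw [hst, hθ, inner_smul_right, norm_smul, mul_pow, Real.norm_eq_abs, sq_abs,
      real_inner_comm] at h1
    have h2 : s * (2 * inner ℝ t θ + s * ‖t‖ ^ 2) = 0 := by linarith
    rcases mul_eq_zero.1 h2 with h3 | h3
    · exact absurd h3 hs
    · linarith
  rw [tangent, curvature, h]
  module

/-- The variance term scales as `n * (n^{-1/2})² = 1`, while the cubic error leaves one spare factor
`n^{-1/2}`. A general filter `l` is allowed so that ultrafilter limits of the directions can be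
used. -/
lemma tendsto_quadratic_sub_log {k : ℕ} [NeZero k] (hk : 2 ≤ k) {l : Filter ℕ} (hl : l ≤ atTop)
    {κs : ℕ → ℝ} {θs hs : ℕ → Vec k} {κ : ℝ} {θ h : Vec k} (hκ : κ ≠ 0)
    (hθs : ∀ n : ℕ, 1 ≤ n → ‖θs n‖ = 1)
    (h1 : Tendsto κs l (𝓝 κ)) (h2 : Tendsto θs l (𝓝 θ)) (h3 : Tendsto hs l (𝓝 h)) :
    Tendsto (fun n : ℕ => n * Real.log (∫ y, Real.exp
      (score (κs n) (θs n) ((√(n : ℝ))⁻¹ • hs n) y) ∂dist (κs n) (θs n))) l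
      (𝓝 (varForm κ θ h / 2)) := by
  have hs0 : Tendsto (fun n : ℕ => (√(n : ℝ))⁻¹) l (𝓝 0) := tendsto_inv_sqrt_nat.mono_left hl
  have hv := (tendsto_varForm hk hκ h1 h2 h3).div_const 2
  have hb : Tendsto (fun n : ℕ => 2 * ‖(√(n : ℝ))⁻¹ • hs n‖) l (𝓝 0) := by
    simpa using (hs0.smul h3).norm.const_mul 2
  -- The constant is `72 = 9 * 2 ^ 3`, from the cumulant bound at `b = 2 * ‖n^{-1/2} • hs n‖`.
  have herr : Tendsto (fun n : ℕ => (√(n : ℝ))⁻¹ * (72 * ‖hs n‖ ^ 3)) l (𝓝 0) := by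
    simpa using hs0.mul ((h3.norm.pow 3).const_mul 72)
  have hdiff : Tendsto (fun n : ℕ => n * Real.log (∫ y, Real.exp
      (score (κs n) (θs n) ((√(n : ℝ))⁻¹ • hs n) y) ∂dist (κs n) (θs n)) -
      varForm (κs n) (θs n) (hs n) / 2) l (𝓝 0) := by
    refine squeeze_zero_norm' ?_ herr
    filter_upwards [hb.eventually_le_const (show (0 : ℝ) < 1 / 2 by norm_num),
      hl (eventually_ge_atTop 1)] with n hbn hn
    have h := abs_log_integral_exp_sub_le (μ := dist (κs n) (θs n))
      (continuous_score (κs n) (θs n) ((√(n : ℝ))⁻¹ • hs n)).measurable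
      (abs_score_le hk (κs n) (hθs n hn) _) (integral_score hk (κs n) (hθs n hn) _) hbn
    rw [integral_score_sq hk _ (hθs n hn), varForm_smul] at h
    have hn0 : (0 : ℝ) < n := by exact_mod_cast hn
    have hsq : (n : ℝ) * (√(n : ℝ))⁻¹ ^ 2 = 1 := by
      rw [inv_pow, Real.sq_sqrt hn0.le, mul_inv_cancel₀ hn0.ne']
    have hs1 : 0 ≤ (√(n : ℝ))⁻¹ := by positivity
    set L := Real.log (∫ y, Real.exp
      (score (κs n) (θs n) ((√(n : ℝ))⁻¹ • hs n) y) ∂dist (κs n) (θs n))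
    calc ‖n * L - varForm (κs n) (θs n) (hs n) / 2‖
        = n * |L - (√(n : ℝ))⁻¹ ^ 2 * varForm (κs n) (θs n) (hs n) / 2| := by
          rw [Real.norm_eq_abs, ← abs_of_pos hn0, ← abs_mul, abs_of_pos hn0]
          congr 1
          linear_combination (varForm (κs n) (θs n) (hs n) / 2) * hsq
      _ ≤ n * (9 * (2 * ‖(√(n : ℝ))⁻¹ • hs n‖) ^ 3) := by gcongr
      _ = (√(n : ℝ))⁻¹ * (72 * ‖hs n‖ ^ 3) := by
          rw [norm_smul, Real.norm_of_nonneg hs1]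
          linear_combination (72 * (√(n : ℝ))⁻¹ * ‖hs n‖ ^ 3) * hsq
  simpa using hdiff.add hv

lemma norm_stack_sq {k : ℕ} (c : ℝ) (t : Vec k) : ‖stack c t‖ ^ 2 = c ^ 2 + ‖t‖ ^ 2 := by
  rw [← real_inner_self_eq_norm_sq, inner_stack, real_inner_self_eq_norm_sq, sq c]

/-- Limits along `atTop` may be checked along filters on which the bounded sequence `(c, t)`
converges. -/
lemma tendsto_of_bounded_stack {k : ℕ} {α : Type*} [TopologicalSpace α] {c : ℕ → ℝ}
    {t : ℕ → Vec k} (hτ : ∃ M : ℝ, ∀ n : ℕ, 1 ≤ n → ‖stack (c n) (t n)‖ ≤ M) {f : ℕ → α} {a : α}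
    (h : ∀ (l : Filter ℕ) (c₀ : ℝ) (t₀ : Vec k), l ≤ atTop → Tendsto c l (𝓝 c₀) →
      Tendsto t l (𝓝 t₀) → Tendsto f l (𝓝 a)) : Tendsto f atTop (𝓝 a) := by
  obtain ⟨M, hM⟩ := hτ
  have hM0 : 0 ≤ M := (norm_nonneg _).trans (hM 1 le_rfl)
  rw [tendsto_iff_ultrafilter]
  intro U hU
  -- Along any ultrafilter finer than `atTop` the bounded pair `(c, t)` converges, by compactness;
  -- this replaces extraction of subsequences.
  have hcpt : IsCompact (Metric.closedBall (0 : ℝ) M ×ˢ Metric.closedBall (0 : Vec k) M) :=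
    (isCompact_closedBall _ _).prod (isCompact_closedBall _ _)
  have hmem : Metric.closedBall (0 : ℝ) M ×ˢ Metric.closedBall (0 : Vec k) M ∈
      U.map (fun n => (c n, t n)) := by
    refine hU ((eventually_ge_atTop 1).mono fun n hn => ?_)
    have h1 := norm_stack_sq (c n) (t n)
    have h2 := pow_le_pow_left₀ (norm_nonneg _) (hM n hn) 2
    constructor
    · rw [mem_closedBall_zero_iff, Real.norm_eq_abs]
      exact abs_le_of_sq_le_sq (by nlinarith [sq_nonneg ‖t n‖]) hM0
    · rw [mem_closedBall_zero_iff]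
      exact le_of_sq_le_sq (by nlinarith [sq_nonneg (c n)]) hM0
  obtain ⟨p, -, hp⟩ := isCompact_iff_ultrafilter_le_nhds'.1 hcpt _ hmem
  have hp' : Tendsto (fun n => (c n, t n)) U (𝓝 p) := hp
  exact h U p.1 p.2 hU hp'.fst_nhds hp'.snd_nhds

/-! ### Central limit theorem for the central sequence. -/

lemma measurable_central {k : ℕ} (n : ℕ) (κ : ℝ) (θ : Vec k) : Measurable (central n κ θ) := by
  have h1 : Measurable (centralI n κ θ) := by unfold centralI; fun_prop
  have h2 : Measurable (centralII n κ θ) := by unfold centralII sgn; fun_prop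
  refine (WithLp.measurable_toLp 2 _).comp (measurable_pi_iff.2 fun i => ?_)
  rcases i with i | i
  · exact h1
  · exact (by fun_prop : Measurable fun v : Vec k => v i).comp h2

lemma charFun_map_central {k : ℕ} [NeZero k] (n : ℕ) (κ : ℝ) {θ : Vec k} (hθ : ‖θ‖ = 1) (c : ℝ)
    (t : Vec k) :
    charFun ((joint n κ θ).map (central n κ θ)) (stack c t) =
      (∫ x, Complex.exp ((((√n)⁻¹ : ℝ) * Complex.I) * score κ θ (tangent κ θ c t) x)
        ∂dist κ θ) ^ n := by
  rw [charFun_apply, integral_map (measurable_central n κ θ).aemeasurable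
    (Measurable.aestronglyMeasurable (by fun_prop))]
  have e : ∀ x : Fin n → Sph k, Complex.exp (inner ℝ (central n κ θ x) (stack c t) * Complex.I) =
      ∏ i, Complex.exp ((((√n)⁻¹ : ℝ) * Complex.I) * score κ θ (tangent κ θ c t) (x i)) := by
    intro x
    rw [real_inner_comm, inner_stack_central n κ hθ, ← Complex.exp_sum, ← Finset.mul_sum]
    congr 1
    simp only [score]
    push_cast
    ring
  simp_rw [e]
  rw [joint, integral_fintype_prod_eq_prod (μ := fun _ : Fin n => dist κ θ)
    (f := fun _ x => Complex.exp ((((√n)⁻¹ : ℝ) * Complex.I) *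
      score κ θ (tangent κ θ c t) x))]
  simp

/-- The one-observation characteristic function is `1 - v / (2n) + O(n^{-3/2})` with `v` the score
variance, uniformly in the moving parameter; its `n`-th power tends to `exp (-v / 2)`. -/
lemma tendsto_charFun_central {k : ℕ} [NeZero k] (hk : 2 ≤ k)
    {κs : ℕ → ℝ} {θs : ℕ → Vec k} {κ : ℝ} {θ : Vec k} (hκ : κ ≠ 0) (hθ : ‖θ‖ = 1)
    (hθs : ∀ n : ℕ, 1 ≤ n → ‖θs n‖ = 1)
    (h1 : Tendsto κs atTop (𝓝 κ)) (h2 : Tendsto θs atTop (𝓝 θ)) (c : ℝ) (t : Vec k) :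
    Tendsto (fun n => charFun ((joint n (κs n) (θs n)).map (central n (κs n) (θs n))) (stack c t))
      atTop (𝓝 (charFun (multivariateGaussian 0 (fisher κ θ)) (stack c t))) := by
  rw [charFun_multivariateGaussian (posSemidef_fisher hk hκ hθ), stack_dotProduct_fisher hk hκ hθ,
    inner_zero_right]
  set h := fun n => tangent (κs n) (θs n) c t with hh
  have h3 : Tendsto h atTop (𝓝 (tangent κ θ c t)) :=
    tendsto_tangent h1 h2 tendsto_const_nhds tendsto_const_nhds
  have hv := (tendsto_varForm hk hκ h1 h2 h3).div_const 2
  have hb : Tendsto (fun n : ℕ => (√(n : ℝ))⁻¹ * (2 * ‖h n‖)) atTop (𝓝 0) := by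
    simpa using tendsto_inv_sqrt_nat.mul (h3.norm.const_mul 2)
  have herr : Tendsto (fun n : ℕ => (√(n : ℝ))⁻¹ * (8 * ‖h n‖ ^ 3)) atTop (𝓝 0) := by
    simpa using tendsto_inv_sqrt_nat.mul ((h3.norm.pow 3).const_mul 8)
  set E : ℕ → ℂ := fun n => ∫ x, Complex.exp ((((√n)⁻¹ : ℝ) * Complex.I) *
    score (κs n) (θs n) (h n) x) ∂dist (κs n) (θs n) with hE
  have hdiff : Tendsto (fun n : ℕ => n * (E n - 1) +
      ((varForm (κs n) (θs n) (h n) / 2 : ℝ) : ℂ)) atTop (𝓝 0) := by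
    refine squeeze_zero_norm' ?_ herr
    filter_upwards [hb.eventually_le_const one_pos, eventually_ge_atTop 1] with n hbn hn
    have hn0 : (0 : ℝ) < n := by exact_mod_cast hn
    have hsq : (n : ℝ) * (√(n : ℝ))⁻¹ ^ 2 = 1 := by
      rw [inv_pow, Real.sq_sqrt hn0.le, mul_inv_cancel₀ hn0.ne']
    have hs1 : 0 ≤ (√(n : ℝ))⁻¹ := by positivity
    have hnorm : ‖((√(n : ℝ))⁻¹ : ℝ) * Complex.I‖ = (√(n : ℝ))⁻¹ := by
      rw [norm_mul, Complex.norm_I, mul_one, Complex.norm_real, Real.norm_of_nonneg hs1]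
    have hle := norm_integral_exp_sub_quadratic_le (μ := dist (κs n) (θs n))
      (continuous_score (κs n) (θs n) (h n)).measurable
      (abs_score_le hk (κs n) (hθs n hn) _) (integral_score hk (κs n) (hθs n hn) _)
      (z := ((√(n : ℝ))⁻¹ : ℝ) * Complex.I) (by rw [hnorm]; exact hbn)
    rw [integral_score_sq hk _ (hθs n hn), hnorm] at hle
    have hsqc : (n : ℂ) * (((√(n : ℝ))⁻¹ : ℝ) : ℂ) ^ 2 = 1 := by exact_mod_cast hsq
    calc ‖n * (E n - 1) + ((varForm (κs n) (θs n) (h n) / 2 : ℝ) : ℂ)‖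
        = ‖(n : ℂ) * (E n - 1 - (((√(n : ℝ))⁻¹ : ℝ) * Complex.I) ^ 2 / 2 *
            (varForm (κs n) (θs n) (h n) : ℝ))‖ := by
          congr 1
          rw [mul_pow, Complex.I_sq]
          push_cast at hsqc ⊢
          linear_combination (-(varForm (κs n) (θs n) (h n) : ℂ) / 2) * hsqc
      _ ≤ n * ((√(n : ℝ))⁻¹ * (2 * ‖h n‖)) ^ 3 := by
          rw [norm_mul, Complex.norm_natCast]
          gcongr
      _ = (√(n : ℝ))⁻¹ * (8 * ‖h n‖ ^ 3) := by
          linear_combination (8 * (√(n : ℝ))⁻¹ * ‖h n‖ ^ 3) * hsq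
  have hlim : Tendsto (fun n : ℕ => n * (E n - 1)) atTop
      (𝓝 (-((varForm κ θ (tangent κ θ c t) / 2 : ℝ) : ℂ))) := by
    have := hdiff.sub ((Complex.continuous_ofReal.tendsto _).comp hv)
    simpa using this
  have hpow := Complex.tendsto_one_add_pow_exp_of_tendsto hlim
  have hgoal : ((0 : ℝ) : ℂ) * Complex.I - (varForm κ θ (tangent κ θ c t) : ℝ) / 2 =
      -((varForm κ θ (tangent κ θ c t) / 2 : ℝ) : ℂ) := by
    push_cast; ring
  rw [hgoal]
  refine hpow.congr' ?_
  filter_upwards [eventually_ge_atTop 1] with n hn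
  rw [charFun_map_central n _ (hθs n hn)]
  simp [hE, hh]

lemma tendstoInDistribution_central {k : ℕ} [NeZero k] (hk : 2 ≤ k)
    {κs : ℕ → ℝ} {θs : ℕ → Vec k} {κ : ℝ} {θ : Vec k} (hκ : κ ≠ 0) (hθ : ‖θ‖ = 1)
    (hθs : ∀ n : ℕ, 1 ≤ n → ‖θs n‖ = 1)
    (h1 : Tendsto κs atTop (𝓝 κ)) (h2 : Tendsto θs atTop (𝓝 θ)) :
    TendstoInDistribution (fun (n : ℕ) (x : Fin n → Sph k) => central n (κs n) (θs n) x)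
      atTop id (fun n : ℕ => joint n (κs n) (θs n))
      (multivariateGaussian 0 (fisher κ θ)) where
  forall_aemeasurable n := (measurable_central n _ _).aemeasurable
  aemeasurable_limit := aemeasurable_id
  tendsto := by
    refine ProbabilityMeasure.tendsto_iff_tendsto_charFun.2 fun τ => ?_
    have hτ : τ = stack (τ (Sum.inl 0)) (WithLp.toLp 2 fun i => τ (Sum.inr i)) := by
      ext i
      rcases i with i | i
      · rw [Subsingleton.elim i 0]; rfl
      · rfl
    rw [hτ]
    simpa only [ProbabilityMeasure.coe_mk, Measure.map_id] using
      tendsto_charFun_central hk hκ hθ hθs h1 h2 (τ (Sum.inl 0))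
        (WithLp.toLp 2 fun i => τ (Sum.inr i))

/-! ### The quadratic expansion of the log-likelihood ratio. -/

lemma tendsto_logLR_remainder {k : ℕ} [NeZero k] (hk : 2 ≤ k)
    {κs : ℕ → ℝ} {θs : ℕ → Vec k} {κ : ℝ} {θ : Vec k} (hκ : κ ≠ 0) (hθ : ‖θ‖ = 1)
    (hθs : ∀ n : ℕ, 1 ≤ n → ‖θs n‖ = 1)
    (h1 : Tendsto κs atTop (𝓝 κ)) (h2 : Tendsto θs atTop (𝓝 θ))
    {c : ℕ → ℝ} {t : ℕ → Vec k}
    (hτ : ∃ M : ℝ, ∀ n : ℕ, 1 ≤ n → ‖stack (c n) (t n)‖ ≤ M)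
    (ht : ∀ n : ℕ, 1 ≤ n → ‖θs n + (√n)⁻¹ • t n‖ = 1) {ε : ℝ} (hε : 0 < ε) :
    Tendsto (fun n : ℕ => joint n (κs n) (θs n)
        {x | ε ≤ |logLR n (κs n + (√n)⁻¹ * c n) (θs n + (√n)⁻¹ • t n) (κs n) (θs n) x
                  - (inner ℝ (stack (c n) (t n)) (central n (κs n) (θs n) x)
                    - 1 / 2 * ((stack (c n) (t n)).ofLp ⬝ᵥ
                        (fisher κ θ).mulVec (stack (c n) (t n)).ofLp))|})
        atTop (𝓝 0) := by
  set r : ℕ → Vec k := fun n => (√(n : ℝ))⁻¹ • curvature (κs n) (θs n) (c n) (t n) with hr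
  set h : ℕ → Vec k := fun n => tangent (κs n) (θs n) (c n) (t n) + r n with hh
  -- The deterministic part of the remainder. Its quadratic term is at the limit `(κ, θ)` and its
  -- cumulant term at `(κs n, θs n)`; both tend to the same value along any filter on which `c` and
  -- `t` converge.
  set D : ℕ → ℝ := fun n => varForm κ θ (tangent κ θ (c n) (t n)) / 2 -
    n * Real.log (∫ y, Real.exp (score (κs n) (θs n) ((√(n : ℝ))⁻¹ • h n) y)
      ∂dist (κs n) (θs n)) with hD
  have hr0 : ∀ (l : Filter ℕ) (c₀ : ℝ) (t₀ : Vec k), l ≤ atTop → Tendsto c l (𝓝 c₀) →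
      Tendsto t l (𝓝 t₀) → Tendsto r l (𝓝 0) := fun l c₀ t₀ hl hc₀ ht₀ => by
    simpa using (tendsto_inv_sqrt_nat.mono_left hl).smul
      (tendsto_curvature (h1.mono_left hl) (h2.mono_left hl) hc₀ ht₀)
  have hDlim : Tendsto D atTop (𝓝 0) := by
    refine tendsto_of_bounded_stack hτ fun l c₀ t₀ hl hc₀ ht₀ => ?_
    have hlim : Tendsto h l (𝓝 (tangent κ θ c₀ t₀)) := by
      simpa using (tendsto_tangent (h1.mono_left hl) (h2.mono_left hl) hc₀ ht₀).add
        (hr0 l c₀ t₀ hl hc₀ ht₀)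
    have ha := (tendsto_varForm hk hκ (tendsto_const_nhds (x := κ) (f := l))
      (tendsto_const_nhds (x := θ)) (tendsto_tangent (tendsto_const_nhds (x := κ))
        (tendsto_const_nhds (x := θ)) hc₀ ht₀)).div_const 2
    have hb := tendsto_quadratic_sub_log hk hl hκ hθs (h1.mono_left hl) (h2.mono_left hl) hlim
    simpa using ha.sub hb
  have hVlim : Tendsto (fun n => ENNReal.ofReal (varForm (κs n) (θs n) (r n) / (ε / 2) ^ 2))
      atTop (𝓝 0) := by
    have : Tendsto (fun n => varForm (κs n) (θs n) (r n)) atTop (𝓝 0) := by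
      refine tendsto_of_bounded_stack hτ fun l c₀ t₀ hl hc₀ ht₀ => ?_
      simpa [varForm] using tendsto_varForm hk hκ (h1.mono_left hl) (h2.mono_left hl)
        (hr0 l c₀ t₀ hl hc₀ ht₀)
    simpa using ENNReal.tendsto_ofReal (this.div_const ((ε / 2) ^ 2))
  refine tendsto_of_tendsto_of_tendsto_of_le_of_le' tendsto_const_nhds hVlim
    (.of_forall fun _ => zero_le) ?_
  have hDsmall : ∀ᶠ n in atTop, |D n| < ε / 2 := by
    simpa using hDlim.abs.eventually_lt_const (by simpa using half_pos hε)
  filter_upwards [hDsmall, eventually_ge_atTop 1] with n hDn hn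
  -- Once `|D n| < ε / 2`, a remainder of at least `ε` forces the curvature sum to be at least `ε /
  -- 2`. The inclusion holds only almost everywhere, like the formula for `logLR`.
  refine le_trans (measure_mono_ae ?_)
    (joint_sum_score_ge_le hk hn (κs n) (hθs n hn) (r n) (half_pos hε))
  have hn0 : (0 : ℝ) < n := by exact_mod_cast hn
  have hs0 : (√(n : ℝ))⁻¹ ≠ 0 := by positivity
  have hδ : (κs n + (√n)⁻¹ * c n) • (θs n + (√n)⁻¹ • t n) - κs n • θs n = (√n)⁻¹ • h n :=
    naturalParameter_sub (κs n) (hθs n hn) (c n) hs0 (ht n hn)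
  filter_upwards [logLR_ae_eq n (κs n) (κs n + (√n)⁻¹ * c n) (θs n) (θs n + (√n)⁻¹ • t n)]
    with x hx hmem
  have hmem' : ε ≤ |logLR n (κs n + (√n)⁻¹ * c n) (θs n + (√n)⁻¹ • t n) (κs n) (θs n) x
      - (inner ℝ (stack (c n) (t n)) (central n (κs n) (θs n) x)
        - 1 / 2 * ((stack (c n) (t n)).ofLp ⬝ᵥ
          (fisher κ θ).mulVec (stack (c n) (t n)).ofLp))| := hmem
  have hsum : logLR n (κs n + (√n)⁻¹ * c n) (θs n + (√n)⁻¹ • t n) (κs n) (θs n) x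
      - (inner ℝ (stack (c n) (t n)) (central n (κs n) (θs n) x)
        - 1 / 2 * ((stack (c n) (t n)).ofLp ⬝ᵥ
          (fisher κ θ).mulVec (stack (c n) (t n)).ofLp)) =
      (√n)⁻¹ * ∑ i, score (κs n) (θs n) (r n) (x i) + D n := by
    have hcentral : inner ℝ (stack (c n) (t n)) (central n (κs n) (θs n) x) = (√n)⁻¹ *
        ∑ i, score (κs n) (θs n) (tangent (κs n) (θs n) (c n) (t n)) (x i) :=
      inner_stack_central n _ (hθs n hn) _ _ _
    have hscore : ∑ i, score (κs n) (θs n) ((√n)⁻¹ • h n) (x i) = (√n)⁻¹ *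
        (∑ i, score (κs n) (θs n) (tangent (κs n) (θs n) (c n) (t n)) (x i) +
          ∑ i, score (κs n) (θs n) (r n) (x i)) := by
      simp only [score_smul, ← Finset.mul_sum, hh, score_add, Finset.sum_add_distrib]
    rw [hx, hδ, hscore, hcentral, stack_dotProduct_fisher hk hκ hθ, hD]
    ring
  rw [hsum] at hmem'
  change ε / 2 ≤ |(√n)⁻¹ * ∑ i, score (κs n) (θs n) (r n) (x i)|
  linarith [abs_add_le ((√n)⁻¹ * ∑ i, score (κs n) (θs n) (r n) (x i)) (D n)]

end FvML

theorem mainTheorem4 (k : ℕ) [NeZero k] (hk : 2 ≤ k)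
    (κ : ℝ) (hκ : 0 < κ) (θ : FvML.Vec k) (hθ : ‖θ‖ = 1)
    (κs : ℕ → ℝ) (θs : ℕ → FvML.Vec k)
    (hκs : ∀ n : ℕ, 1 ≤ n → 0 < κs n) (hθs : ∀ n : ℕ, 1 ≤ n → ‖θs n‖ = 1)
    (hκO : (fun n : ℕ => κs n - κ) =O[atTop] fun n : ℕ => (Real.sqrt n)⁻¹)
    (hθO : (fun n : ℕ => θs n - θ) =O[atTop] fun n : ℕ => (Real.sqrt n)⁻¹)
    (c : ℕ → ℝ) (t : ℕ → FvML.Vec k)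
    (hτ : ∃ M : ℝ, ∀ n : ℕ, 1 ≤ n → ‖FvML.stack (c n) (t n)‖ ≤ M)
    (hc : ∀ n : ℕ, 1 ≤ n → 0 < κs n + (Real.sqrt n)⁻¹ * c n)
    (ht : ∀ n : ℕ, 1 ≤ n → ‖θs n + (Real.sqrt n)⁻¹ • t n‖ = 1) :
    (∀ ε : ℝ, 0 < ε →
      Tendsto (fun n : ℕ => FvML.joint n (κs n) (θs n)
        {x | ε ≤ |FvML.logLR n (κs n + (Real.sqrt n)⁻¹ * c n) (θs n + (Real.sqrt n)⁻¹ • t n)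
                    (κs n) (θs n) x
                  - (inner ℝ (FvML.stack (c n) (t n)) (FvML.central n (κs n) (θs n) x)
                    - 1 / 2 * ((FvML.stack (c n) (t n)).ofLp ⬝ᵥ
                        (FvML.fisher κ θ).mulVec (FvML.stack (c n) (t n)).ofLp))|})
        atTop (𝓝 0)) ∧
    (FvML.fisher κ θ).PosSemidef ∧
    TendstoInDistribution (fun (n : ℕ) (x : Fin n → FvML.Sph k) => FvML.central n (κs n) (θs n) x)
      atTop id (fun n : ℕ => FvML.joint n (κs n) (θs n))
      (multivariateGaussian 0 (FvML.fisher κ θ)) :=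
 by
  have tendsto_of_isBigO : ∀ {E : Type} [NormedAddCommGroup E] {u : ℕ → E} {a : E},
      (fun n => u n - a) =O[atTop] (fun n : ℕ => (Real.sqrt n)⁻¹) → Tendsto u atTop (𝓝 a) :=
    fun h => tendsto_sub_nhds_zero_iff.1 (h.trans_tendsto FvML.tendsto_inv_sqrt_nat)
  have h1 := tendsto_of_isBigO hκO
  have h2 := tendsto_of_isBigO hθO
  exact ⟨fun ε hε => FvML.tendsto_logLR_remainder hk hκ.ne' hθ hθs h1 h2 hτ ht hε,
    FvML.posSemidef_fisher hk hκ.ne' hθ,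
    FvML.tendstoInDistribution_central hk hκ.ne' hθ hθs h1 h2⟩
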